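/- Let $\Gamma$ be a finite index subgroup of $\mathrm{SL}(2,\mathbb Z)$ and let $k\in\frac12\mathbb Z$ with $k\ge \frac52$. For $g=\left(\begin{smallmatrix}a&b\\c&d\end{smallmatrix}\right)\in\mathrm{SL}(2,\mathbb R)$ and $z\in\mathbb H$ put $j(g,z)=cz+d$, and for real $r$ put $w_r(g,h)=j(g,hz)^{r}j(h,z)^{r}j(gh,z)^{-r}$ (principal branch; the value is independent of $z$). A multiplier system of weight $r$ for $\Gamma$ is a function $\nu:\Gamma\to\mathbb C$ with $|\nu(\gamma)|=1$ and $\nu(\gamma\delta)=w_r(\gamma,\delta)\nu(\gamma)\nu(\delta)$ for all $\gamma,\delta\in\Gamma$, and $\nu(-I)=e^{-\pi i r}$ if $-I\in\Gamma$. Let $\nu$ be a multiplier system of weight $2-k$ for $\Gamma$. For a cusp $\mathfrak a$ of $\Gamma$ let $\Gamma_{\mathfrak a}$ be its stabilizer in $\Gamma$. A scaling matrix for $\mathfrak a$ is a $\sigma_{\mathfrak a}\in\mathrm{SL}(2,\mathbb R)$ with $\sigma_{\mathfrak a}\infty=\mathfrak a$ and $\sigma_{\mathfrak a}^{-1}\{\pm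 I\}\Gamma_{\mathfrak a}\sigma_{\mathfrak a}=\{\pm\left(\begin{smallmatrix}1&n\\0&1\end{smallmatrix}\right):n\in\mathbb Z\}$. The cusp $\mathfrak a$ is singular for $\nu$ if $\nu(\delta)\,j(\delta,z)^{2-k}j(\sigma_{\mathfrak a}^{-1},\delta z)^{2-k}=j(\sigma_{\mathfrak a}^{-1},z)^{2-k}$ for all $\delta\in\Gamma_{\mathfrak a}$ and $z\in\mathbb H$ (if $-I\in\Gamma$ this means that $\nu=1$ on the unipotent elements of $\Gamma_{\mathfrak a}$). For a singular cusp $\mathfrak a$ define the mock Eisenstein series of weight $2-k$ by $$\mathcal E_{2-k}(\Gamma,\nu,z,\mathfrak a)=\frac{y^{k-1}}{k-1}\sum_{\gamma\in\Gamma_{\mathfrak a}\backslash\Gamma}\overline{\nu(\gamma)}\;\overline{w_{2-k}(\sigma_{\mathfrak a}^{-1},\gamma)}\;j(\sigma_{\mathfrak a}^{-1}\gamma,z)^{k-2}\,|j(\sigma_{\mathfrak a}^{-1}\gamma,z)|^{-2(k-1)},\qquad y=\operatorname{Im} z,$$ and let $\mathfrak E^{\#}_{2-k}(\Gamma,\nu)$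 be the complex vector space of functions on $\mathbb H$ spanned by the series $\mathcal E_{2-k}(\Gamma,\nu,z,\mathfrak a)$, where $\mathfrak a$ runs over all singular cusps of $\Gamma$ and $\sigma_{\mathfrak a}$ over all scaling matrices for $\mathfrak a$. Then $\mathfrak E^{\#}_{2-k}(\Gamma,\nu)$ is finite-dimensional. Moreover, let $k\ge 3$ be an integer, $N\ge1$, and let $\chi$ be a Dirichlet character modulo $N$ with $\chi(-1)=(-1)^k$, viewed as the multiplier system $\left(\begin{smallmatrix}a&b\\c&d\end{smallmatrix}\right)\mapsto\chi(d)$ of weight $2-k$ for $\Gamma_0(N)$. Then $$\dim_{\mathbb C}\mathfrak E^{\#}_{2-k}(\Gamma_0(N),\chi)=\sum_{\substack{C\mid N\\ \gcd(C,N/C)\,\mid\, N/m_{\overline\chi}}}\phi(\gcd(C,N/C)),$$ where $C$ runs over the positive divisors of $N$, $m_{\overline\chi}$ is the conductor of $\overline\chi$ and $\phi$ is Euler's function. -/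

import Mathlib

open scoped MatrixGroups UpperHalfPlane

namespace MockEisenstein

noncomputable section

/-- The inclusion of a subgroup `Γ` of `SL(2, ℤ)` into `SL(2, ℝ)`. -/
def incl (Γ : Subgroup SL(2, ℤ)) : Γ →* SL(2, ℝ) :=
  (Matrix.SpecialLinearGroup.map (Int.castRingHom ℝ)).comp Γ.subtype

/-- The automorphy factor `j(g, z) = c z + d`. -/
def j (g : SL(2, ℝ)) (z : ℍ) : ℂ := (g 1 0 : ℂ) * (z : ℂ) + (g 1 1 : ℂ)

/-- The factor `w(g, h) = j(g, h z)^r j(h, z)^r j(g h, z)^{-r}` of weight `r`, with powers taken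
on the principal branch. Its value does not depend on `z`. -/
def w (r : ℝ) (g h : SL(2, ℝ)) (z : ℍ) : ℂ :=
  j g (h • z) ^ (r : ℂ) * j h z ^ (r : ℂ) * j (g * h) z ^ (-(r : ℂ))

/-- A multiplier system of weight `r` for a subgroup `Γ` of `SL(2, ℤ)`. -/
structure MultiplierSystem (Γ : Subgroup SL(2, ℤ)) (r : ℝ) where
  /-- the underlying function -/
  toFun : Γ → ℂ
  norm_eq_one : ∀ γ, ‖toFun γ‖ = 1
  map_mul : ∀ (γ δ : Γ) (z : ℍ),
    toFun (γ * δ) = w r (incl Γ γ) (incl Γ δ) z * toFun γ * toFun δ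
  map_neg_one : ∀ γ : Γ, (γ : SL(2, ℤ)) = -1 →
    toFun γ = Complex.exp (-(Real.pi * Complex.I * r))

instance (Γ : Subgroup SL(2, ℤ)) (r : ℝ) : CoeFun (MultiplierSystem Γ r) (fun _ => Γ → ℂ) :=
  ⟨MultiplierSystem.toFun⟩

/-- The stabiliser `Γ_𝔞` of the point `a` of `ℙ¹(ℝ)` in `Γ`. -/
def cuspStabilizer (Γ : Subgroup SL(2, ℤ)) (a : OnePoint ℝ) : Subgroup Γ :=
  (MulAction.stabilizer (GL (Fin 2) ℝ) a).comap
    ((Matrix.SpecialLinearGroup.mapGL ℝ).comp Γ.subtype)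

/-- `σ ∈ SL(2, ℝ)` is a scaling matrix for the cusp `a` of `Γ`: `σ ∞ = a`, and the conjugate by
`σ⁻¹` of `{±1} Γ_𝔞` is the stabiliser of `∞` in `SL(2, ℤ)`. (When `-1 ∈ Γ`, the group `{±1} Γ_𝔞`
is `Γ_𝔞` itself.) -/
def IsScalingMatrix (Γ : Subgroup SL(2, ℤ)) (a : OnePoint ℝ) (σ : SL(2, ℝ)) : Prop :=
  (σ : GL (Fin 2) ℝ) • (OnePoint.infty : OnePoint ℝ) = a ∧
  ∀ g : SL(2, ℝ),
    (∃ γ ∈ cuspStabilizer Γ a, g = incl Γ γ ∨ g = -incl Γ γ) ↔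
    ∃ τ : SL(2, ℤ), τ 1 0 = 0 ∧
      Matrix.SpecialLinearGroup.map (Int.castRingHom ℝ) τ = σ⁻¹ * g * σ

/-- The cusp `a`, with scaling matrix `σ`, is singular for the multiplier system `ν` of weight
`r`: the automorphy factor `ν(δ) j(δ, z)^r`, transported to `∞` by `σ`, is trivial on the
stabiliser `Γ_𝔞`. For a unipotent `δ = σ (1 n; 0 1) σ⁻¹` the condition says `ν(δ) = 1`, and for
`δ = -1` it says `ν(-1) = e^{-πir}`, which holds for every multiplier system. So for `-1 ∈ Γ` it
says exactly that `ν` is trivial on the unipotent elements of `Γ_𝔞`. -/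
def IsSingular {Γ : Subgroup SL(2, ℤ)} {r : ℝ} (ν : MultiplierSystem Γ r) (a : OnePoint ℝ)
    (σ : SL(2, ℝ)) : Prop :=
  ∀ δ ∈ cuspStabilizer Γ a, ∀ z : ℍ,
    ν δ * j (incl Γ δ) z ^ (r : ℂ) * j σ⁻¹ (incl Γ δ • z) ^ (r : ℂ) = j σ⁻¹ z ^ (r : ℂ)

/-- A cusp of `Γ` that is singular for `ν`, together with a scaling matrix. -/
structure SingularCusp {Γ : Subgroup SL(2, ℤ)} {r : ℝ} (ν : MultiplierSystem Γ r) where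
  /-- the cusp -/
  pt : OnePoint ℝ
  /-- the scaling matrix -/
  σ : SL(2, ℝ)
  isCusp : IsCusp pt (Γ.map (Matrix.SpecialLinearGroup.mapGL ℝ))
  isScaling : IsScalingMatrix Γ pt σ
  isSingular : IsSingular ν pt σ

/-- The summand
`conj ν(γ) · conj w(σ⁻¹, γ) · j(σ⁻¹ γ, z)^{-r} · |j(σ⁻¹ γ, z)|^{-2s}` of the Eisenstein series. -/
def eisTerm {Γ : Subgroup SL(2, ℤ)} {r : ℝ} (ν : MultiplierSystem Γ r) (c : SingularCusp ν)
    (s : ℂ) (z : ℍ) (γ : Γ) : ℂ :=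
  (starRingEnd ℂ) (ν γ) * (starRingEnd ℂ) (w r c.σ⁻¹ (incl Γ γ) z) *
    j (c.σ⁻¹ * incl Γ γ) z ^ (-(r : ℂ)) * (‖j (c.σ⁻¹ * incl Γ γ) z‖ : ℂ) ^ (-2 * s)

theorem j_eq_denom (g : SL(2, ℝ)) (z : ℍ) :
    j g z = UpperHalfPlane.denom (g : GL (Fin 2) ℝ) z := rfl

theorem j_ne_zero (g : SL(2, ℝ)) (z : ℍ) : j g z ≠ 0 := by
  rw [j_eq_denom]; exact UpperHalfPlane.denom_ne_zero _ _

theorem j_mul (g h : SL(2, ℝ)) (z : ℍ) : j (g * h) z = j g (h • z) * j h z := by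
  have h1 := UpperHalfPlane.denom_cocycle_σ (g : GL (Fin 2) ℝ) (h : GL (Fin 2) ℝ) z
  have h2 : UpperHalfPlane.σ (h : GL (Fin 2) ℝ) = ContinuousAlgEquiv.refl ℝ ℂ := by
    simp [UpperHalfPlane.σ]
  rw [h2] at h1
  have h3 : h • z = (h : GL (Fin 2) ℝ) • z := rfl
  rw [j_eq_denom, j_eq_denom, j_eq_denom, h3]
  simpa using h1

theorem norm_w (r : ℝ) (g h : SL(2, ℝ)) (z : ℍ) : ‖w r g h z‖ = 1 := by
  have e : (-(r : ℂ)) = ((-r : ℝ) : ℂ) := by push_cast; ring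
  have p := norm_pos_iff.mpr (j_ne_zero g (h • z))
  have q := norm_pos_iff.mpr (j_ne_zero h z)
  rw [w, e, norm_mul, norm_mul, Complex.norm_cpow_real, Complex.norm_cpow_real,
    Complex.norm_cpow_real, j_mul, norm_mul, ← Real.mul_rpow p.le q.le,
    ← Real.rpow_add (mul_pos p q)]
  simp

/-- The summand of the Eisenstein series in closed form. -/
theorem eisTerm_eq {Γ : Subgroup SL(2, ℤ)} {r : ℝ} (ν : MultiplierSystem Γ r)
    (c : SingularCusp ν) (s : ℂ) (z : ℍ) (γ : Γ) :
    eisTerm ν c s z γ =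
      (ν γ * j c.σ⁻¹ (incl Γ γ • z) ^ (r : ℂ) * j (incl Γ γ) z ^ (r : ℂ))⁻¹ *
        (‖j (c.σ⁻¹ * incl Γ γ) z‖ : ℂ) ^ (-2 * s) := by
  rw [eisTerm, ← Complex.inv_eq_conj (ν.norm_eq_one γ), ← Complex.inv_eq_conj (norm_w _ _ _ _)]
  congr 1
  have h0 := j_ne_zero (c.σ⁻¹ * incl Γ γ) z
  have h1 : j (c.σ⁻¹ * incl Γ γ) z ^ (r : ℂ) ≠ 0 := by simp [Complex.cpow_eq_zero_iff, h0]
  rw [w, Complex.cpow_neg]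
  field_simp

/-- The absolute value of `j(σ⁻¹ γ, z)` depends only on the coset `Γ_𝔞 γ`. -/
theorem norm_j_mul_left {Γ : Subgroup SL(2, ℤ)} {a : OnePoint ℝ} {σ : SL(2, ℝ)}
    (hσ : IsScalingMatrix Γ a σ) (z : ℍ) (δ γ : Γ) (hδ : δ ∈ cuspStabilizer Γ a) :
    ‖j (σ⁻¹ * incl Γ (δ * γ)) z‖ = ‖j (σ⁻¹ * incl Γ γ) z‖ := by
  obtain ⟨τ, h0, hτ⟩ := (hσ.2 (incl Γ δ)).mp ⟨δ, hδ, Or.inl rfl⟩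
  have e : σ⁻¹ * incl Γ (δ * γ) =
      Matrix.SpecialLinearGroup.map (Int.castRingHom ℝ) τ * (σ⁻¹ * incl Γ γ) := by
    rw [hτ, map_mul]; group
  have hd : τ 0 0 * τ 1 1 = 1 := by
    have := Matrix.det_fin_two (τ : Matrix (Fin 2) (Fin 2) ℤ)
    rw [τ.det_coe, h0] at this
    linarith
  have hu : |((τ 1 1 : ℤ) : ℝ)| = 1 := by
    rcases Int.isUnit_iff.mp (IsUnit.of_mul_eq_one_right _ hd) with h | h <;> simp [h]
  rw [e, j_mul, norm_mul]
  have : ‖j (Matrix.SpecialLinearGroup.map (Int.castRingHom ℝ) τ) ((σ⁻¹ * incl Γ γ) • z)‖ = 1 := by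
    simp [j, h0]
    exact_mod_cast hu
  rw [this, one_mul]

/-- The summand depends only on the coset `Γ_𝔞 γ`. -/
theorem eisTerm_mul_left {Γ : Subgroup SL(2, ℤ)} {r : ℝ} (ν : MultiplierSystem Γ r)
    (c : SingularCusp ν) (s : ℂ) (z : ℍ) (δ γ : Γ) (hδ : δ ∈ cuspStabilizer Γ c.pt) :
    eisTerm ν c s z (δ * γ) = eisTerm ν c s z γ := by
  rw [eisTerm_eq, eisTerm_eq, norm_j_mul_left c.isScaling z δ γ hδ]
  congr 2
  rw [ν.map_mul δ γ z, w, ← c.isSingular δ hδ (incl Γ γ • z), map_mul, mul_smul,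
    Complex.cpow_neg]
  have h0 := j_ne_zero (incl Γ δ * incl Γ γ) z
  have h1 : j (incl Γ δ * incl Γ γ) z ^ (r : ℂ) ≠ 0 := by simp [Complex.cpow_eq_zero_iff, h0]
  field_simp

/-- The nonholomorphic Eisenstein series
`E_r(Γ, ν, z, 𝔞, s) = ∑_{γ ∈ Γ_𝔞 \ Γ} conj ν(γ) conj w(σ⁻¹, γ) j(σ⁻¹γ, z)^{-r} |j(σ⁻¹γ, z)|^{-2s}`
of weight `r`; the sum converges absolutely for `r + 2 Re s > 2`. -/
def eisensteinSeries {Γ : Subgroup SL(2, ℤ)} {r : ℝ} (ν : MultiplierSystem Γ r)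
    (c : SingularCusp ν) (s : ℂ) (z : ℍ) : ℂ :=
  ∑' q : Quotient (QuotientGroup.rightRel (cuspStabilizer Γ c.pt)),
    Quotient.lift (eisTerm ν c s z) (fun γ₁ γ₂ h => by
      have h' := QuotientGroup.rightRel_apply.mp h
      have := eisTerm_mul_left ν c s z (γ₂ * γ₁⁻¹) γ₁ h'
      simpa using this.symm) q

/-- The mock Eisenstein series
`𝓔_{2-k}(Γ, ν, z, 𝔞) = y^{k-1} / (k-1) · E_{2-k}(Γ, ν, z, 𝔞, k-1)` of weight `2 - k`. -/
def mockEisensteinSeries {Γ : Subgroup SL(2, ℤ)} (k : ℝ) (ν : MultiplierSystem Γ (2 - k))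
    (c : SingularCusp ν) (z : ℍ) : ℂ :=
  ((z.im ^ (k - 1) / (k - 1) : ℝ) : ℂ) * eisensteinSeries ν c ((k : ℂ) - 1) z

/-- The space spanned by the mock Eisenstein series of all cusps of `Γ`
(that are singular for `ν`). -/
def mockEisensteinSpace {Γ : Subgroup SL(2, ℤ)} (k : ℝ) (ν : MultiplierSystem Γ (2 - k)) :
    Submodule ℂ (ℍ → ℂ) :=
  Submodule.span ℂ (Set.range (mockEisensteinSeries k ν))

/-- For an integer `k` and a Dirichlet character `χ` modulo `N` with `χ(-1) = (-1)^k`, the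
multiplier system `(a b; c d) ↦ χ(d)` of weight `2 - k` for `Γ₀(N)`. -/
def nebentypus {N : ℕ} [NeZero N] (χ : DirichletCharacter ℂ N) (k : ℤ)
    (hχ : χ (-1) = (-1) ^ k) :
    MultiplierSystem (CongruenceSubgroup.Gamma0 N) (2 - (k : ℝ)) where
  toFun γ := χ (((γ : SL(2, ℤ)) 1 1 : ℤ) : ZMod N)
  norm_eq_one γ := by
    have h : (Units.map (CongruenceSubgroup.Gamma0Map N) (toUnits γ) : ZMod N) =
      (((γ : SL(2, ℤ)) 1 1 : ℤ) : ZMod N) := rfl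
    rw [← h]
    exact χ.unit_norm_eq_one _
  map_mul γ δ z := by
    have h : ((((γ * δ : CongruenceSubgroup.Gamma0 N) : SL(2, ℤ)) 1 1 : ℤ) : ZMod N) =
        (((γ : SL(2, ℤ)) 1 1 : ℤ) : ZMod N) * (((δ : SL(2, ℤ)) 1 1 : ℤ) : ZMod N) :=
      map_mul (CongruenceSubgroup.Gamma0Map N) γ δ
    have e : (((2 - (k : ℝ) : ℝ)) : ℂ) = ((2 - k : ℤ) : ℂ) := by push_cast; ring
    have hw : w (2 - (k : ℝ)) (incl _ γ) (incl _ δ) z = 1 := by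
      have h1 := j_ne_zero (incl _ γ) (incl _ δ • z)
      have h2 := j_ne_zero (incl _ δ) z
      rw [w, e, Complex.cpow_neg, Complex.cpow_intCast, Complex.cpow_intCast,
        Complex.cpow_intCast, j_mul, ← mul_zpow]
      exact mul_inv_cancel₀ (zpow_ne_zero _ (mul_ne_zero h1 h2))
    rw [h, map_mul, hw, one_mul]
  map_neg_one γ hγ := by
    have h : (((γ : SL(2, ℤ)) 1 1 : ℤ) : ZMod N) = -1 := by simp [hγ]
    have e : -(Real.pi * Complex.I * ((2 - (k : ℝ) : ℝ) : ℂ)) =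
        ((k - 2 : ℤ) : ℂ) * (Real.pi * Complex.I) := by push_cast; ring
    rw [h, hχ, e, Complex.exp_int_mul, Complex.exp_pi_mul_I, zpow_sub₀ (by norm_num)]
    norm_num

end

end MockEisenstein

/-! The theorem rests on how a series depends on its cusp and how it grows there. If γ ∈ Γ carries
one singular cusp to another, the automorphy factors transported to ∞ differ by a nonzero constant
(`exists_factor`), so reindexing the cosets by γ makes the two series proportional. With γ = 1 this
also shows that the scaling matrix matters only up to a constant. Finite index leaves finitely many
classes of cusps, hence a finite-dimensional span.

For k > 2, series at pairwise inequivalent cusps are independent. A summand has absolute value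
|j|^(-k), and bottom rows embed the cosets in ℤ², so limits along a sequence tending to a cusp may
be taken termwise (`tendsto_eisensteinSeries_ratio`). Divided by the leading term at that cusp, its
own series tends to 1 and the others to 0. The dimension is therefore the number of classes of
singular cusps.

For Γ₀(N) these are counted. The cusp p/q is determined up to equivalence by C = gcd(q, N) and the
class of p(q/C) modulo G = gcd(C, N/C) (`cuspEquiv_iff`). This class is a unit and every unit
occurs, which gives φ(G) cusps for each C ∣ N. On the unipotent stabiliser χ takes precisely its
values at residues 1 + (N/G)x, so the cusp is singular iff the conductor divides N/G
(`isSingular_nebentypus_iff`). -/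

namespace MockEisenstein

open Matrix.SpecialLinearGroup ModularGroup Filter Topology

/-! ### Scaling matrices at equivalent cusps -/

/-- The embedding of `SL(2, ℤ)` into `SL(2, ℝ)`. -/
noncomputable def toReal : SL(2, ℤ) →* SL(2, ℝ) :=
  Matrix.SpecialLinearGroup.map (Int.castRingHom ℝ)

@[simp] theorem toReal_apply (g : SL(2, ℤ)) (a b : Fin 2) : toReal g a b = (g a b : ℝ) := rfl

theorem incl_eq {Γ : Subgroup SL(2, ℤ)} (γ : Γ) : incl Γ γ = toReal γ := rfl

theorem coe_toReal (g : SL(2, ℤ)) : ((toReal g : SL(2, ℝ)) : GL (Fin 2) ℝ) = mapGL ℝ g := rfl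

theorem smul_infty_eq_iff (g h : GL (Fin 2) ℝ) :
    g • (OnePoint.infty : OnePoint ℝ) = h • OnePoint.infty ↔ (h⁻¹ * g) 1 0 = 0 := by
  rw [← OnePoint.smul_infty_eq_self_iff, mul_smul, inv_smul_eq_iff]

theorem mapGL_smul_infty_eq_iff (g h : SL(2, ℤ)) :
    mapGL ℝ g • (OnePoint.infty : OnePoint ℝ) = mapGL ℝ h • OnePoint.infty ↔
      (h⁻¹ * g) 1 0 = 0 := by
  rw [smul_infty_eq_iff, ← map_inv, ← map_mul]
  exact Int.cast_eq_zero (α := ℝ)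

theorem SingularCusp.exists_rep {Γ : Subgroup SL(2, ℤ)} {r : ℝ} {ν : MultiplierSystem Γ r}
    (c : SingularCusp ν) : ∃ g : SL(2, ℤ), c.pt = mapGL ℝ g • OnePoint.infty := by
  refine isCusp_SL2Z_iff'.mp (c.isCusp.mono ?_)
  rintro _ ⟨g, -, rfl⟩
  exact ⟨g, rfl⟩

theorem mem_cuspStabilizer {Γ : Subgroup SL(2, ℤ)} {a : OnePoint ℝ} (δ : Γ) :
    δ ∈ cuspStabilizer Γ a ↔ mapGL ℝ (δ : SL(2, ℤ)) • a = a := Iff.rfl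

theorem mem_cuspStabilizer_iff {Γ : Subgroup SL(2, ℤ)} (g : SL(2, ℤ)) (δ : Γ) :
    δ ∈ cuspStabilizer Γ (mapGL ℝ g • OnePoint.infty) ↔ (g⁻¹ * δ * g) 1 0 = 0 := by
  rw [mem_cuspStabilizer, ← mul_smul, ← map_mul, mapGL_smul_infty_eq_iff, mul_assoc]

theorem conj_mem_cuspStabilizer {Γ : Subgroup SL(2, ℤ)} {a b : OnePoint ℝ} {γ : Γ}
    (h : b = mapGL ℝ (γ : SL(2, ℤ)) • a) (δ : Γ) :
    γ * δ * γ⁻¹ ∈ cuspStabilizer Γ b ↔ δ ∈ cuspStabilizer Γ a := by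
  rw [mem_cuspStabilizer, mem_cuspStabilizer, h]
  simp [mul_smul]

/-- Two scaling matrices at equivalent cusps differ by an upper triangular matrix whose first
entry squares to an integer. -/
theorem exists_int_sq {Γ : Subgroup SL(2, ℤ)} {a b : OnePoint ℝ} {σ σ' : SL(2, ℝ)} {γ : Γ}
    (hσ : IsScalingMatrix Γ a σ) (hσ' : IsScalingMatrix Γ b σ')
    (h : b = mapGL ℝ (γ : SL(2, ℤ)) • a) :
    (σ'⁻¹ * incl Γ γ * σ) 1 0 = 0 ∧ ∃ n : ℤ, (σ'⁻¹ * incl Γ γ * σ) 0 0 ^ 2 = n := by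
  set m := σ'⁻¹ * incl Γ γ * σ with hm
  have h0 : m 1 0 = 0 := by
    have h1 := hσ'.1
    rw [h, ← hσ.1, ← coe_toReal, ← mul_smul, eq_comm, smul_infty_eq_iff] at h1
    rw [hm, mul_assoc]
    exact h1
  refine ⟨h0, ?_⟩
  -- The scaling condition at `a` gives σTσ⁻¹ = ±δ; conjugating by γ and applying the condition at
  -- `b` shows that mTm⁻¹ is integral up to sign. Its upper right entry is the square of the first
  -- entry of m.
  obtain ⟨δ, hδ, hg⟩ := (hσ.2 (σ * toReal ModularGroup.T * σ⁻¹)).mpr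
    ⟨ModularGroup.T, by simp [ModularGroup.T], by
      change toReal ModularGroup.T = _; group⟩
  obtain ⟨τ, -, hτ⟩ := (hσ'.2 (incl Γ (γ * δ * γ⁻¹))).mp
    ⟨_, (conj_mem_cuspStabilizer h δ).mpr hδ, Or.inl rfl⟩
  have hdet : m 0 0 * m 1 1 = 1 := by
    have := Matrix.det_fin_two (m : Matrix (Fin 2) (Fin 2) ℝ)
    rw [m.det_coe, h0] at this
    linarith
  have key : (m * toReal ModularGroup.T * m⁻¹) 0 1 = m 0 0 ^ 2 := by
    have hT : ((toReal ModularGroup.T : SL(2, ℝ)) : Matrix (Fin 2) (Fin 2) ℝ) = !![1, 1; 0, 1] := by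
      rw [Matrix.eta_fin_two (toReal ModularGroup.T : Matrix (Fin 2) (Fin 2) ℝ)]
      simp [ModularGroup.coe_T]
    rw [coe_mul, coe_mul, hT, Matrix.SpecialLinearGroup.coe_inv, Matrix.adjugate_fin_two]
    simp [Matrix.mul_apply, Fin.sum_univ_two]
    ring
  rcases hg with hg | hg
  · refine ⟨τ 0 1, ?_⟩
    rw [← key, ← toReal_apply, show toReal τ = _ from hτ, map_mul, map_mul, ← hg, hm, map_inv]
    simp [mul_assoc]
  · refine ⟨-τ 0 1, ?_⟩
    rw [Int.cast_neg, ← key, ← toReal_apply, show toReal τ = _ from hτ, map_mul, map_mul,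
      ← neg_eq_iff_eq_neg.mpr hg, hm, map_inv]
    simp [mul_assoc]

/-- Applied to γ and to γ⁻¹, `exists_int_sq` makes the squares of both diagonal entries of m
integers. Their product is 1, so the diagonal entries are ±1. -/
theorem exists_sign_j_eq {Γ : Subgroup SL(2, ℤ)} {a b : OnePoint ℝ} {σ σ' : SL(2, ℝ)} {γ : Γ}
    (hσ : IsScalingMatrix Γ a σ) (hσ' : IsScalingMatrix Γ b σ')
    (h : b = mapGL ℝ (γ : SL(2, ℤ)) • a) :
    ∃ u : ℝ, (u = 1 ∨ u = -1) ∧ ∀ z, j (σ'⁻¹ * incl Γ γ) z = u * j σ⁻¹ z := by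
  obtain ⟨h0, n, hn⟩ := exists_int_sq hσ hσ' h
  obtain ⟨-, n', hn'⟩ := exists_int_sq (γ := γ⁻¹) hσ' hσ (by simp [h])
  set m := σ'⁻¹ * incl Γ γ * σ with hm
  have hinv : σ⁻¹ * incl Γ γ⁻¹ * σ' = m⁻¹ := by rw [hm, map_inv]; group
  have hdet : m 0 0 * m 1 1 = 1 := by
    have := Matrix.det_fin_two (m : Matrix (Fin 2) (Fin 2) ℝ)
    rw [m.det_coe, h0] at this
    linarith
  rw [hinv] at hn'
  have e11 : (m⁻¹) 0 0 = m 1 1 := by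
    simp [Matrix.SpecialLinearGroup.coe_inv, Matrix.adjugate_fin_two]
  rw [e11] at hn'
  have hnn : n * n' = 1 := by
    have : ((n * n' : ℤ) : ℝ) = 1 := by
      push_cast; rw [← hn, ← hn', ← mul_pow, hdet, one_pow]
    exact_mod_cast this
  have hn1 : m 1 1 ^ 2 = 1 := by
    rcases Int.isUnit_iff.mp (IsUnit.of_mul_eq_one_right _ hnn) with h | h
    · simp [hn', h]
    · rw [h] at hn'; push_cast at hn'; nlinarith [sq_nonneg (m 1 1)]
  refine ⟨m 1 1, by simpa using hn1, fun z => ?_⟩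
  have : σ'⁻¹ * incl Γ γ = m * σ⁻¹ := by rw [hm]; group
  rw [this, j_mul]
  simp [j, h0]

/-! ### Proportional series and finite dimension -/

/-- The branch cut is harmless: either c = 0 and j is constant, or c ≠ 0 and j is never real. -/
theorem continuous_j_cpow (g : SL(2, ℝ)) (r : ℂ) : Continuous fun z : ℍ => j g z ^ r := by
  by_cases h : g 1 0 = 0
  · simp only [j, h, Complex.ofReal_zero, zero_mul, zero_add]
    exact continuous_const
  · refine Continuous.cpow ?_ continuous_const fun z => Or.inr ?_
    · unfold j
      exact (continuous_const.mul UpperHalfPlane.continuous_coe).add continuous_const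
    · simpa [j, h] using z.im_ne_zero

theorem cpow_sq_of_two_mul {r : ℂ} {n : ℤ} (h : 2 * r = n) (x : ℂ) : (x ^ r) ^ 2 = x ^ n := by
  rw [← Complex.cpow_nat_mul, Nat.cast_ofNat, h, Complex.cpow_intCast]

/-- For half-integral weight, the automorphy factors attached to scaling matrices at equivalent
cusps differ by a constant. -/
theorem exists_factor {Γ : Subgroup SL(2, ℤ)} {r : ℝ} {n : ℤ} (hr : 2 * (r : ℂ) = n)
    {a b : OnePoint ℝ} {σ σ' : SL(2, ℝ)} {γ : Γ}
    (hσ : IsScalingMatrix Γ a σ) (hσ' : IsScalingMatrix Γ b σ')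
    (h : b = mapGL ℝ (γ : SL(2, ℤ)) • a) :
    ∃ u : ℂ, u ≠ 0 ∧ ∀ z : ℍ,
      j (incl Γ γ) z ^ (r : ℂ) * j σ'⁻¹ (incl Γ γ • z) ^ (r : ℂ) = u * j σ⁻¹ z ^ (r : ℂ) := by
  obtain ⟨ε, hε, hj⟩ := exists_sign_j_eq hσ hσ' h
  have hne (g : SL(2, ℝ)) (z : ℍ) : j g z ^ (r : ℂ) ≠ 0 := by
    simp [Complex.cpow_eq_zero_iff, j_ne_zero]
  -- Since 2r is an integer, the square of this quotient is constant. Being continuous and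
  -- nonvanishing on the connected ℍ, the quotient is itself constant.
  set f : ℍ → ℂ := fun z =>
    j (incl Γ γ) z ^ (r : ℂ) * j σ'⁻¹ (incl Γ γ • z) ^ (r : ℂ) / j σ⁻¹ z ^ (r : ℂ) with hf
  have hf0 (z : ℍ) : f z ≠ 0 := div_ne_zero (mul_ne_zero (hne _ _) (hne _ _)) (hne _ _)
  have hsq (z : ℍ) : f z ^ 2 = (ε : ℂ) ^ n := by
    rw [hf]
    simp only [div_pow, mul_pow, cpow_sq_of_two_mul hr]
    rw [← mul_zpow, mul_comm, ← j_mul, hj, mul_zpow, mul_div_cancel_right₀]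
    exact zpow_ne_zero _ (j_ne_zero _ _)
  have hcont : Continuous f :=
    ((continuous_j_cpow _ _).mul
      ((continuous_j_cpow σ'⁻¹ r).comp (continuous_const_smul (incl Γ γ)))).div
      (continuous_j_cpow _ _) (fun z => hne _ z)
  refine ⟨f UpperHalfPlane.I, hf0 _, fun z => ?_⟩
  have := isPreconnected_univ.eq_of_sq_eq (f := f) (g := fun _ => f UpperHalfPlane.I)
    hcont.continuousOn continuousOn_const (fun z _ => by simp [hsq]) (fun _ => hf0 _)
    (Set.mem_univ UpperHalfPlane.I) rfl (Set.mem_univ z)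
  refine (?_ : _ = f z * _).trans (congrArg (· * _) this)
  exact (div_mul_cancel₀ _ (hne _ _)).symm

/-- Right cosets of the stabilisers of equivalent cusps correspond to each other. -/
noncomputable def cosetEquiv {Γ : Subgroup SL(2, ℤ)} {a b : OnePoint ℝ} {γ : Γ}
    (h : b = mapGL ℝ (γ : SL(2, ℤ)) • a) :
    Quotient (QuotientGroup.rightRel (cuspStabilizer Γ a)) ≃
      Quotient (QuotientGroup.rightRel (cuspStabilizer Γ b)) :=
  Quotient.congr (Equiv.mulLeft γ) fun δ₁ δ₂ => by
    rw [QuotientGroup.rightRel_apply, QuotientGroup.rightRel_apply,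
      ← conj_mem_cuspStabilizer h]
    simp [mul_assoc]

theorem eisTerm_equivalent {Γ : Subgroup SL(2, ℤ)} {r : ℝ} {n : ℤ} (hr : 2 * (r : ℂ) = n)
    {ν : MultiplierSystem Γ r} {c c' : SingularCusp ν} {γ : Γ}
    (h : c'.pt = mapGL ℝ (γ : SL(2, ℤ)) • c.pt) :
    ∃ u : ℂ, u ≠ 0 ∧ ∀ s z δ, eisTerm ν c' s z (γ * δ) = u * eisTerm ν c s z δ := by
  obtain ⟨u, hu, hz⟩ := exists_factor hr c.isScaling c'.isScaling h
  obtain ⟨ε, hε, hj⟩ := exists_sign_j_eq c.isScaling c'.isScaling h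
  have hν (γ : Γ) : ν γ ≠ 0 := norm_ne_zero_iff.mp (by simp [ν.norm_eq_one])
  have hne (g : SL(2, ℝ)) (z : ℍ) : j g z ^ (r : ℂ) ≠ 0 := by
    simp [Complex.cpow_eq_zero_iff, j_ne_zero]
  refine ⟨(ν γ * u)⁻¹, inv_ne_zero (mul_ne_zero (hν γ) hu), fun s z δ => ?_⟩
  have hnorm : ‖j (c'.σ⁻¹ * incl Γ (γ * δ)) z‖ = ‖j (c.σ⁻¹ * incl Γ δ) z‖ := by
    rw [map_mul, ← mul_assoc, j_mul, hj, j_mul c.σ⁻¹]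
    rcases hε with rfl | rfl <;> simp
  rw [eisTerm_eq, eisTerm_eq, hnorm, ← mul_assoc, ← mul_inv]
  congr 2
  have := hz (incl Γ δ • z)
  rw [ν.map_mul γ δ z, w, map_mul, mul_smul, Complex.cpow_neg]
  field_simp [hne]
  linear_combination (ν γ * ν δ) * this

theorem mockEisensteinSeries_equivalent {Γ : Subgroup SL(2, ℤ)} {k : ℝ}
    (hk : ∃ m : ℤ, k = m / 2) {ν : MultiplierSystem Γ (2 - k)} {c c' : SingularCusp ν} {γ : Γ}
    (h : c'.pt = mapGL ℝ (γ : SL(2, ℤ)) • c.pt) :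
    ∃ u : ℂ, u ≠ 0 ∧ mockEisensteinSeries k ν c' = u • mockEisensteinSeries k ν c := by
  obtain ⟨m, hm⟩ := hk
  obtain ⟨u, hu, hterm⟩ := eisTerm_equivalent (n := 4 - m) (by rw [hm]; push_cast; ring) h
  refine ⟨u, hu, funext fun z => ?_⟩
  rw [Pi.smul_apply, smul_eq_mul, mockEisensteinSeries, mockEisensteinSeries, mul_left_comm]
  congr 1
  rw [eisensteinSeries, eisensteinSeries, ← tsum_mul_left, ← (cosetEquiv h).tsum_eq]
  refine tsum_congr fun q => ?_
  induction q using Quotient.inductionOn with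
  | h δ => exact hterm _ z δ

theorem finiteDimensional_mockEisensteinSpace (Γ : Subgroup SL(2, ℤ)) [Γ.FiniteIndex] {k : ℝ}
    (hk : ∃ m : ℤ, k = m / 2) (ν : MultiplierSystem Γ (2 - k)) :
    FiniteDimensional ℂ (mockEisensteinSpace k ν) := by
  classical
  choose g hg using fun c : SingularCusp ν => c.exists_rep
  -- The inverse turns the coset Γg into a left coset: equal values mean g'g⁻¹ ∈ Γ, and this element
  -- carries g∞ to g'∞.
  let φ : SingularCusp ν → SL(2, ℤ) ⧸ Γ := fun c => ((g c)⁻¹ : SL(2, ℤ))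
  have hφ (c c' : SingularCusp ν) (h : φ c = φ c') :
      ∃ u : ℂ, u ≠ 0 ∧ mockEisensteinSeries k ν c' = u • mockEisensteinSeries k ν c := by
    have h1 : g c' * (g c)⁻¹ ∈ Γ := by simpa [φ] using QuotientGroup.eq.mp h.symm
    refine mockEisensteinSeries_equivalent hk (γ := ⟨_, h1⟩) ?_
    rw [hg c, hg c', ← mul_smul, ← map_mul]
    simp
  choose rep hrep using fun q : Set.range φ => q.2
  have hle : mockEisensteinSpace k ν ≤
      Submodule.span ℂ (Set.range (mockEisensteinSeries k ν ∘ rep)) := by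
    refine Submodule.span_le.mpr ?_
    rintro _ ⟨c, rfl⟩
    obtain ⟨u, -, hu⟩ := hφ (rep ⟨φ c, c, rfl⟩) c (hrep _)
    rw [SetLike.mem_coe, hu]
    exact Submodule.smul_mem _ _ (Submodule.subset_span ⟨_, rfl⟩)
  have := FiniteDimensional.span_of_finite ℂ (Set.finite_range (mockEisensteinSeries k ν ∘ rep))
  exact Submodule.finiteDimensional_of_le hle

/-! ### Growth at the cusps and linear independence -/

/-- The exponents combine as -(2 - k) - 2(k - 1) = -k, so the series is dominated like a holomorphic
Eisenstein series of weight k. -/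
theorem norm_eisTerm {Γ : Subgroup SL(2, ℤ)} {k : ℝ} (ν : MultiplierSystem Γ (2 - k))
    (c : SingularCusp ν) (z : ℍ) (γ : Γ) :
    ‖eisTerm ν c ((k : ℂ) - 1) z γ‖ = ‖j (c.σ⁻¹ * incl Γ γ) z‖ ^ (-k) := by
  have hp := norm_pos_iff.mpr (j_ne_zero (c.σ⁻¹ * incl Γ γ) z)
  have e1 : (-((2 - k : ℝ) : ℂ)) = ((k - 2 : ℝ) : ℂ) := by push_cast; ring
  have e2 : (-2 * ((k : ℂ) - 1)) = ((-2 * (k - 1) : ℝ) : ℂ) := by push_cast; ring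
  rw [eisTerm, e1, e2, norm_mul, norm_mul, norm_mul, RCLike.norm_conj, RCLike.norm_conj,
    ν.norm_eq_one, norm_w, Complex.norm_cpow_real, Complex.norm_cpow_real, Complex.norm_real,
    norm_norm, one_mul, one_mul, ← Real.rpow_add hp]
  congr 1; ring

/-- Replacing σ by an integral matrix with the same image of ∞ costs only a real constant, so growth
can be read from integral bottom rows. -/
theorem exists_j_eq {σ : SL(2, ℝ)} {g : SL(2, ℤ)}
    (hσ : (σ : GL (Fin 2) ℝ) • (OnePoint.infty : OnePoint ℝ) = mapGL ℝ g • OnePoint.infty) :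
    ∃ x : ℝ, x ≠ 0 ∧ ∀ h z, j (σ⁻¹ * h) z = x * j ((toReal g)⁻¹ * h) z := by
  set m := σ⁻¹ * toReal g with hm
  have h0 : m 1 0 = 0 := by
    rw [← coe_toReal, eq_comm, smul_infty_eq_iff] at hσ
    exact hσ
  have hdet : m 0 0 * m 1 1 = 1 := by
    have := Matrix.det_fin_two (m : Matrix (Fin 2) (Fin 2) ℝ)
    rw [m.det_coe, h0] at this
    linarith
  refine ⟨m 1 1, right_ne_zero_of_mul (hdet ▸ one_ne_zero), fun h z => ?_⟩
  have : σ⁻¹ * h = m * ((toReal g)⁻¹ * h) := by rw [hm]; group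
  rw [this, j_mul]
  simp [j, h0]

/-- The points `i, 2i, 3i, …` of the upper half-plane. -/
noncomputable def imPoint (n : ℕ) : ℍ := ⟨((n + 1 : ℝ) : ℂ) * Complex.I, by simp; positivity⟩

theorem coe_imPoint (n : ℕ) : (imPoint n : ℂ) = ((n + 1 : ℝ) : ℂ) * Complex.I := rfl

theorem j_toReal_imPoint_re (g : SL(2, ℤ)) (n : ℕ) : (j (toReal g) (imPoint n)).re = g 1 1 := by
  simp [j, coe_imPoint]

theorem j_toReal_imPoint_im (g : SL(2, ℤ)) (n : ℕ) :
    (j (toReal g) (imPoint n)).im = g 1 0 * (n + 1) := by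
  simp [j, coe_imPoint]

theorem abs_le_norm_j_imPoint (g : SL(2, ℤ)) (n : ℕ) :
    |(g 1 0 : ℝ)| * (n + 1) ≤ ‖j (toReal g) (imPoint n)‖ := by
  have := Complex.abs_im_le_norm (j (toReal g) (imPoint n))
  rwa [j_toReal_imPoint_im, abs_mul, abs_of_pos (by positivity : (0 : ℝ) < n + 1)] at this

/-- The points have imaginary part at least 1, so |c| and |d| are both bounded by |j|. The bound is
uniform in `n`, as domination requires. -/
theorem norm_row_le_norm_j_imPoint (g : SL(2, ℤ)) (n : ℕ) :
    ‖g 1‖ ≤ ‖j (toReal g) (imPoint n)‖ := by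
  rw [pi_norm_le_iff_of_nonneg (norm_nonneg _)]
  intro a
  rw [Int.norm_eq_abs]
  fin_cases a
  · refine le_trans ?_ (abs_le_norm_j_imPoint g n)
    exact le_mul_of_one_le_right (abs_nonneg _) (by simp)
  · have := Complex.abs_re_le_norm (j (toReal g) (imPoint n))
    rwa [j_toReal_imPoint_re] at this

theorem norm_row_pos (g : SL(2, ℤ)) : 0 < ‖g 1‖ := by
  refine norm_pos_iff.mpr fun h => ?_
  have := Matrix.det_fin_two (g : Matrix (Fin 2) (Fin 2) ℤ)
  rw [g.det_coe] at this
  simp [congrFun h 0, congrFun h 1] at this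

theorem tendsto_norm_j_imPoint {k : ℝ} (hk : 0 < k) {g : SL(2, ℤ)} (hg : g 1 0 ≠ 0) :
    Tendsto (fun n => ‖j (toReal g) (imPoint n)‖ ^ (-k)) atTop (𝓝 0) := by
  refine (tendsto_rpow_neg_atTop hk).comp (tendsto_atTop_mono (fun n => ?_)
    (tendsto_natCast_atTop_atTop (R := ℝ)))
  refine le_trans ?_ (abs_le_norm_j_imPoint g n)
  have : (1 : ℝ) ≤ |(g 1 0 : ℝ)| := by exact_mod_cast Int.one_le_abs hg
  nlinarith [(Nat.cast_nonneg n : (0 : ℝ) ≤ n)]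

/-- The summand at a coset of `Γ_𝔞`. -/
noncomputable def cosetTerm {Γ : Subgroup SL(2, ℤ)} {r : ℝ} (ν : MultiplierSystem Γ r)
    (c : SingularCusp ν) (s : ℂ) (z : ℍ)
    (q : Quotient (QuotientGroup.rightRel (cuspStabilizer Γ c.pt))) : ℂ :=
  eisTerm ν c s z q.out

theorem eisTerm_out {Γ : Subgroup SL(2, ℤ)} {r : ℝ} (ν : MultiplierSystem Γ r)
    (c : SingularCusp ν) (s : ℂ) (z : ℍ) (γ : Γ) :
    cosetTerm ν c s z (Quotient.mk _ γ) = eisTerm ν c s z γ := by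
  have h := QuotientGroup.rightRel_apply.mp
    (Quotient.mk_out (s := QuotientGroup.rightRel (cuspStabilizer Γ c.pt)) γ)
  rw [cosetTerm, ← eisTerm_mul_left ν c s z _ _ h, inv_mul_cancel_right]

theorem eisensteinSeries_eq_tsum {Γ : Subgroup SL(2, ℤ)} {r : ℝ} (ν : MultiplierSystem Γ r)
    (c : SingularCusp ν) (s : ℂ) (z : ℍ) :
    eisensteinSeries ν c s z = ∑' q, cosetTerm ν c s z q := by
  refine tsum_congr fun q => ?_
  induction q using Quotient.inductionOn with
  | h δ => exact (eisTerm_out ν c s z δ).symm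

section

variable {Γ : Subgroup SL(2, ℤ)} {k : ℝ} {ν : MultiplierSystem Γ (2 - k)}

/-- The factor |j(h, ·)|, common to both summands, cancels; the constant does not depend on γ or
`n`. -/
theorem exists_norm_ratio (c d : SingularCusp ν) {g h : SL(2, ℤ)}
    (hg : c.pt = mapGL ℝ g • OnePoint.infty) (hh : d.pt = mapGL ℝ h • OnePoint.infty) :
    ∃ K : ℝ, ∀ γ n, ‖eisTerm ν c ((k : ℂ) - 1) (toReal h • imPoint n) γ /
        eisTerm ν d ((k : ℂ) - 1) (toReal h • imPoint n) 1‖ =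
      K * ‖j (toReal (g⁻¹ * γ * h)) (imPoint n)‖ ^ (-k) := by
  obtain ⟨x, hx, hxj⟩ := exists_j_eq (c.isScaling.1.trans hg)
  obtain ⟨y, hy, hyj⟩ := exists_j_eq (d.isScaling.1.trans hh)
  refine ⟨|x| ^ (-k) / |y| ^ (-k), fun γ n => ?_⟩
  have hJ := norm_pos_iff.mpr (j_ne_zero (toReal h) (imPoint n))
  have e1 : j ((toReal g)⁻¹ * incl Γ γ) (toReal h • imPoint n) =
      j (toReal (g⁻¹ * γ * h)) (imPoint n) / j (toReal h) (imPoint n) := by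
    rw [eq_div_iff (j_ne_zero _ _), ← j_mul, map_mul, map_mul, map_inv, incl_eq]
  have e2 : j ((toReal h)⁻¹ * incl Γ 1) (toReal h • imPoint n) =
      1 / j (toReal h) (imPoint n) := by
    rw [eq_div_iff (j_ne_zero _ _), ← j_mul, map_one, mul_one, inv_mul_cancel]
    simp [j]
  rw [norm_div, norm_eisTerm, norm_eisTerm, hxj, hyj, e1, e2, norm_mul, norm_mul, norm_div,
    norm_div, Complex.norm_real, Complex.norm_real, Real.norm_eq_abs, Real.norm_eq_abs, norm_one,
    Real.mul_rpow (abs_nonneg _) (by positivity), Real.mul_rpow (abs_nonneg _) (by positivity),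
    Real.div_rpow (norm_nonneg _) hJ.le, Real.div_rpow zero_le_one hJ.le, Real.one_rpow]
  have h1 : |y| ^ (-k) ≠ 0 := (Real.rpow_pos_of_pos (abs_pos.mpr hy) _).ne'
  have h2 := (Real.rpow_pos_of_pos hJ (-k)).ne'
  field_simp

/-- If A and B have the same bottom row, then AB⁻¹ fixes ∞. Hence the sum over cosets is dominated
by a sum over part of the lattice ℤ². -/
theorem injective_row {a : OnePoint ℝ} {g : SL(2, ℤ)} (hg : a = mapGL ℝ g • OnePoint.infty)
    (h : SL(2, ℤ)) : Function.Injective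
      fun q : Quotient (QuotientGroup.rightRel (cuspStabilizer Γ a)) =>
        (g⁻¹ * (q.out : Γ) * h) 1 := by
  subst hg
  intro q q' e
  rw [← q.out_eq, ← q'.out_eq, eq_comm]
  refine Quotient.sound (QuotientGroup.rightRel_apply.mpr ?_)
  rw [mem_cuspStabilizer_iff]
  have e' : g⁻¹ * ((q.out * q'.out⁻¹ : Γ) : SL(2, ℤ)) * g =
      (g⁻¹ * (q.out : Γ) * h) * (g⁻¹ * (q'.out : Γ) * h)⁻¹ := by
    simp [mul_assoc]
  have h0 : (g⁻¹ * (q.out : Γ) * h) 1 0 = (g⁻¹ * (q'.out : Γ) * h) 1 0 := congrFun e 0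
  have h1 : (g⁻¹ * (q.out : Γ) * h) 1 1 = (g⁻¹ * (q'.out : Γ) * h) 1 1 := congrFun e 1
  rw [e']
  generalize g⁻¹ * (q.out : Γ) * h = A at h0 h1
  generalize g⁻¹ * (q'.out : Γ) * h = B at h0 h1
  rw [coe_mul, Matrix.SpecialLinearGroup.coe_inv, Matrix.adjugate_fin_two]
  simp [Matrix.mul_apply, Fin.sum_univ_two, h0, h1]
  ring

/-- Termwise passage to the limit in the Eisenstein series of `c`, normalised by the leading term
at the cusp `d`. -/
theorem tendsto_eisensteinSeries_ratio (hk : 2 < k) (c d : SingularCusp ν) {g h : SL(2, ℤ)}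
    (hg : c.pt = mapGL ℝ g • OnePoint.infty) (hh : d.pt = mapGL ℝ h • OnePoint.infty)
    (L : Quotient (QuotientGroup.rightRel (cuspStabilizer Γ c.pt)) → ℂ)
    (hL : ∀ q, ((g⁻¹ * (q.out : Γ) * h) 1 0 ≠ 0 ∧ L q = 0) ∨
      ∀ n, cosetTerm ν c ((k : ℂ) - 1) (toReal h • imPoint n) q /
        eisTerm ν d ((k : ℂ) - 1) (toReal h • imPoint n) 1 = L q) :
    Tendsto (fun n => eisensteinSeries ν c ((k : ℂ) - 1) (toReal h • imPoint n) /
        eisTerm ν d ((k : ℂ) - 1) (toReal h • imPoint n) 1) atTop (𝓝 (∑' q, L q)) := by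
  obtain ⟨K, hK⟩ := exists_norm_ratio c d hg hh
  have hK0 : 0 ≤ K := by
    have h1 := hK 1 0
    have h2 := Real.rpow_pos_of_pos
      (norm_pos_iff.mpr (j_ne_zero (toReal (g⁻¹ * (1 : Γ) * h)) (imPoint 0))) (-k)
    exact nonneg_of_mul_nonneg_left (h1 ▸ norm_nonneg _) h2
  simp_rw [eisensteinSeries_eq_tsum, ← tsum_div_const]
  -- The majorant is a subseries of the sum of ‖(c, d)‖^(-k) over ℤ², which converges because k > 2.
  refine tendsto_tsum_of_dominated_convergence
    (bound := fun q => K * ‖(g⁻¹ * (q.out : Γ) * h) 1‖ ^ (-k)) ?_ (fun q => ?_)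
    (Eventually.of_forall fun n q => ?_)
  · exact ((EisensteinSeries.summable_one_div_norm_rpow hk).comp_injective
      (injective_row hg h)).mul_left K
  · rcases hL q with ⟨h1, h2⟩ | h1
    · rw [h2, tendsto_zero_iff_norm_tendsto_zero]
      simp only [cosetTerm, hK]
      simpa using (tendsto_norm_j_imPoint (by linarith) h1).const_mul K
    · simp [h1]
  · rw [cosetTerm, hK]
    exact mul_le_mul_of_nonneg_left (Real.rpow_le_rpow_of_nonpos (norm_row_pos _)
      (norm_row_le_norm_j_imPoint _ _) (by linarith)) hK0

theorem eisTerm_ne_zero (c : SingularCusp ν) (z : ℍ) (γ : Γ) :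
    eisTerm ν c ((k : ℂ) - 1) z γ ≠ 0 := by
  rw [← norm_ne_zero_iff, norm_eisTerm]
  exact (Real.rpow_pos_of_pos (norm_pos_iff.mpr (j_ne_zero _ _)) _).ne'

/-- The lower left entry of g⁻¹γg vanishes only for γ in the stabiliser, so only the identity coset
survives. -/
theorem tendsto_eisensteinSeries_self (hk : 2 < k) (c : SingularCusp ν) {g : SL(2, ℤ)}
    (hg : c.pt = mapGL ℝ g • OnePoint.infty) :
    Tendsto (fun n => eisensteinSeries ν c ((k : ℂ) - 1) (toReal g • imPoint n) /
        eisTerm ν c ((k : ℂ) - 1) (toReal g • imPoint n) 1) atTop (𝓝 1) := by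
  classical
  let q₀ : Quotient (QuotientGroup.rightRel (cuspStabilizer Γ c.pt)) := Quotient.mk _ 1
  have := tendsto_eisensteinSeries_ratio hk c c hg hg (Pi.single q₀ 1) fun q => ?_
  · rwa [tsum_pi_single] at this
  · by_cases hq : q = q₀
    · subst hq
      right
      intro n
      rw [eisTerm_out, div_self (eisTerm_ne_zero _ _ _), Pi.single_eq_same]
    · left
      refine ⟨fun h0 => hq ?_, Pi.single_eq_of_ne hq _⟩
      rw [← mem_cuspStabilizer_iff, ← hg] at h0
      rw [← q.out_eq]
      refine Quotient.sound (QuotientGroup.rightRel_apply.mpr ?_)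
      simpa using inv_mem h0

/-- A vanishing lower left entry of g⁻¹γh would mean that γ carries `d` to `c`, so every term
decays. -/
theorem tendsto_eisensteinSeries_of_not_equivalent (hk : 2 < k) (c d : SingularCusp ν)
    (hcd : ∀ γ : Γ, c.pt ≠ mapGL ℝ (γ : SL(2, ℤ)) • d.pt) {h : SL(2, ℤ)}
    (hh : d.pt = mapGL ℝ h • OnePoint.infty) :
    Tendsto (fun n => eisensteinSeries ν c ((k : ℂ) - 1) (toReal h • imPoint n) /
        eisTerm ν d ((k : ℂ) - 1) (toReal h • imPoint n) 1) atTop (𝓝 0) := by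
  obtain ⟨g, hg⟩ := c.exists_rep
  have := tendsto_eisensteinSeries_ratio hk c d hg hh 0 fun q => Or.inl ⟨fun h0 => ?_, rfl⟩
  · simpa using this
  · apply hcd q.out
    refine hg.trans ?_
    rw [hh, ← mul_smul, ← map_mul, eq_comm, mapGL_smul_infty_eq_iff, ← mul_assoc, h0]

/-- The mock Eisenstein series of pairwise inequivalent singular cusps are linearly
independent. -/
theorem linearIndependent_mockEisensteinSeries (hk : 2 < k) {ι : Type*} (c : ι → SingularCusp ν)
    (hc : ∀ i i', i ≠ i' → ∀ γ : Γ, (c i).pt ≠ mapGL ℝ (γ : SL(2, ℤ)) • (c i').pt) :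
    LinearIndependent ℂ fun i => mockEisensteinSeries k ν (c i) := by
  classical
  rw [linearIndependent_iff']
  intro s a hs i₀ hi₀
  obtain ⟨h, hh⟩ := (c i₀).exists_rep
  have hz (z : ℍ) : ∑ i ∈ s, a i * eisensteinSeries ν (c i) ((k : ℂ) - 1) z = 0 := by
    have h1 := congrFun hs z
    have hp : ((z.im ^ (k - 1) / (k - 1) : ℝ) : ℂ) ≠ 0 := by
      have := Real.rpow_pos_of_pos z.im_pos (k - 1)
      exact Complex.ofReal_ne_zero.mpr (div_pos this (by linarith)).ne'
    simp only [Finset.sum_apply, Pi.smul_apply, smul_eq_mul, Pi.zero_apply,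
      mockEisensteinSeries, mul_left_comm _ ((z.im ^ (k - 1) / (k - 1) : ℝ) : ℂ)] at h1
    rw [← Finset.mul_sum] at h1
    exact (mul_eq_zero.mp h1).resolve_left hp
  -- Along points tending to the cusp of `i₀`, the normalised relation isolates the coefficient `a
  -- i₀`.
  have hlim : Tendsto (fun n => ∑ i ∈ s, a i *
      (eisensteinSeries ν (c i) ((k : ℂ) - 1) (toReal h • imPoint n) /
        eisTerm ν (c i₀) ((k : ℂ) - 1) (toReal h • imPoint n) 1)) atTop
      (𝓝 (∑ i ∈ s, a i * if i = i₀ then 1 else 0)) := by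
    refine tendsto_finsetSum _ fun i _ => Tendsto.const_mul _ ?_
    split_ifs with hi
    · subst hi
      exact tendsto_eisensteinSeries_self hk _ hh
    · exact tendsto_eisensteinSeries_of_not_equivalent hk _ _ (hc _ _ hi) hh
  simp only [← mul_div_assoc, ← Finset.sum_div, hz, zero_div] at hlim
  have := tendsto_nhds_unique hlim tendsto_const_nhds
  simpa [hi₀] using this

end

/-! ### Classification of the cusps of Γ₀(N) -/

theorem exists_eq_T_zpow {τ : SL(2, ℤ)} (h : τ 1 0 = 0) : ∃ t : ℤ, τ = T ^ t ∨ τ = -T ^ t := by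
  have hd := Matrix.det_fin_two (τ : Matrix (Fin 2) (Fin 2) ℤ)
  rw [τ.det_coe, h, mul_zero, sub_zero] at hd
  rcases Int.isUnit_iff.mp (IsUnit.of_mul_eq_one_right _ hd.symm) with h1 | h1
  · have h0 : τ 0 0 = 1 := by rw [h1] at hd; linarith
    refine ⟨τ 0 1, Or.inl (Subtype.ext ?_)⟩
    rw [coe_T_zpow]
    exact (Matrix.eta_fin_two _).trans (by rw [h, h0, h1])
  · have h0 : τ 0 0 = -1 := by rw [h1] at hd; linarith
    refine ⟨-τ 0 1, Or.inr (Subtype.ext ?_)⟩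
    rw [coe_neg, coe_T_zpow]
    exact (Matrix.eta_fin_two _).trans (by rw [h, h0, h1]; simp)

/-- Up to sign, the elements of SL(2, ℤ) carrying g∞ to h∞ are hTᵗg⁻¹; this entry decides which of
them lie in Γ₀(N). -/
theorem mul_T_zpow_mul_inv_apply (g h : SL(2, ℤ)) (t : ℤ) :
    (h * T ^ t * g⁻¹) 1 0 = h 1 0 * g 1 1 - g 1 0 * h 1 1 - t * (g 1 0 * h 1 0) := by
  rw [coe_mul, coe_mul, coe_T_zpow, Matrix.SpecialLinearGroup.coe_inv, Matrix.adjugate_fin_two]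
  simp [Matrix.mul_apply, Fin.sum_univ_two]
  ring

theorem conj_T_zpow_apply_one_zero (g : SL(2, ℤ)) (t : ℤ) :
    (g * T ^ t * g⁻¹) 1 0 = -(t * g 1 0 ^ 2) := by
  rw [mul_T_zpow_mul_inv_apply]; ring

theorem conj_T_zpow_apply_one_one (g : SL(2, ℤ)) (t : ℤ) :
    (g * T ^ t * g⁻¹) 1 1 = 1 + t * (g 0 0 * g 1 0) := by
  have hd := Matrix.det_fin_two (g : Matrix (Fin 2) (Fin 2) ℤ)
  rw [g.det_coe] at hd
  rw [coe_mul, coe_mul, coe_T_zpow, Matrix.SpecialLinearGroup.coe_inv, Matrix.adjugate_fin_two]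
  simp [Matrix.mul_apply, Fin.sum_univ_two]
  linear_combination -hd

theorem mem_Gamma0_iff_dvd {N : ℕ} {g : SL(2, ℤ)} :
    g ∈ CongruenceSubgroup.Gamma0 N ↔ (N : ℤ) ∣ g 1 0 := by
  rw [CongruenceSubgroup.Gamma0_mem, ZMod.intCast_zmod_eq_zero_iff_dvd]

/-- The divisor `gcd(q, N)` of `N` attached to the cusp `p / q` of `Γ₀(N)`. -/
def cuspDivisor (N : ℕ) (g : SL(2, ℤ)) : ℕ := Int.gcd (g 1 0) N

/-- The modulus `gcd(C, N / C)` of the cusps `p / q` with `gcd(q, N) = C`. -/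
def cuspModulus (N C : ℕ) : ℕ := Nat.gcd C (N / C)

/-- The class of `p (q / C)` modulo `gcd(C, N / C)` attached to the cusp `p / q` of `Γ₀(N)` with
`gcd(q, N) = C`. -/
def cuspResidue (N : ℕ) (g : SL(2, ℤ)) : ℤ :=
  g 0 0 * (g 1 0 / (cuspDivisor N g : ℤ)) % (cuspModulus N (cuspDivisor N g) : ℤ)

theorem cuspDivisor_dvd (N : ℕ) (g : SL(2, ℤ)) : cuspDivisor N g ∣ N :=
  Int.natCast_dvd_natCast.mp (Int.gcd_dvd_right _ _)

theorem cuspDivisor_mul (N : ℕ) (g : SL(2, ℤ)) :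
    (cuspDivisor N g : ℤ) * (g 1 0 / (cuspDivisor N g : ℤ)) = g 1 0 :=
  Int.mul_ediv_cancel' (Int.gcd_dvd_left _ _)

theorem isCoprime_cofactor (N : ℕ) [NeZero N] (g : SL(2, ℤ)) :
    IsCoprime (g 1 0 / (cuspDivisor N g : ℤ)) ((N / cuspDivisor N g : ℕ) : ℤ) := by
  rw [Int.isCoprime_iff_gcd_eq_one, Int.natCast_div]
  exact Int.gcd_ediv_gcd_ediv_gcd (Int.gcd_pos_of_ne_zero_right _ (by simp [NeZero.ne N]))

theorem cuspModulus_dvd_left (N C : ℕ) : cuspModulus N C ∣ C := Nat.gcd_dvd_left _ _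

theorem cuspModulus_dvd_right (N C : ℕ) : cuspModulus N C ∣ N / C := Nat.gcd_dvd_right _ _

theorem isCoprime_col (g : SL(2, ℤ)) : IsCoprime (g 0 0) (g 1 0) := by
  have hd := Matrix.det_fin_two (g : Matrix (Fin 2) (Fin 2) ℤ)
  rw [g.det_coe] at hd
  exact ⟨g 1 1, -g 0 1, by linear_combination -hd⟩

/-- p is prime to q, hence to C, while q/C is prime to N/C; G divides both C and N/C. -/
theorem isCoprime_residue (N : ℕ) [NeZero N] (g : SL(2, ℤ)) :
    IsCoprime (g 0 0 * (g 1 0 / (cuspDivisor N g : ℤ)))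
      (cuspModulus N (cuspDivisor N g) : ℤ) := by
  refine IsCoprime.mul_left ?_ ?_
  · refine (isCoprime_col g).of_isCoprime_of_dvd_right ?_
    rw [← cuspDivisor_mul N g]
    exact (Int.natCast_dvd_natCast.mpr (cuspModulus_dvd_left _ _)).mul_right _
  · exact (isCoprime_cofactor N g).of_isCoprime_of_dvd_right
      (Int.natCast_dvd_natCast.mpr (cuspModulus_dvd_right _ _))

/-- The images of `∞` under `g` and `h` are equivalent under `Γ₀(N)`. -/
def CuspEquiv (N : ℕ) (g h : SL(2, ℤ)) : Prop :=
  ∃ γ : CongruenceSubgroup.Gamma0 N, mapGL ℝ h • (OnePoint.infty : OnePoint ℝ) =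
    mapGL ℝ (γ : SL(2, ℤ)) • mapGL ℝ g • (OnePoint.infty : OnePoint ℝ)

theorem CuspEquiv.symm {N : ℕ} {g h : SL(2, ℤ)} (hgh : CuspEquiv N g h) : CuspEquiv N h g := by
  obtain ⟨γ, hγ⟩ := hgh
  exact ⟨γ⁻¹, by simp [hγ]⟩

theorem CuspEquiv.exists_col {N : ℕ} {g h : SL(2, ℤ)} (hgh : CuspEquiv N g h) :
    ∃ γ : CongruenceSubgroup.Gamma0 N, ∃ ε : ℤ, ε * ε = 1 ∧
      ε * h 0 0 = (γ : SL(2, ℤ)) 0 0 * g 0 0 + (γ : SL(2, ℤ)) 0 1 * g 1 0 ∧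
      ε * h 1 0 = (γ : SL(2, ℤ)) 1 0 * g 0 0 + (γ : SL(2, ℤ)) 1 1 * g 1 0 := by
  obtain ⟨γ, hγ⟩ := hgh
  rw [← mul_smul, ← map_mul, eq_comm, mapGL_smul_infty_eq_iff] at hγ
  have hd := Matrix.det_fin_two ((h⁻¹ * (γ * g) : SL(2, ℤ)) : Matrix (Fin 2) (Fin 2) ℤ)
  rw [Matrix.SpecialLinearGroup.det_coe, hγ, mul_zero, sub_zero] at hd
  set τ := h⁻¹ * (γ * g) with hτ
  have e : (γ : SL(2, ℤ)) * g = h * τ := by rw [hτ]; group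
  have hent (a : Fin 2) : ((γ : SL(2, ℤ)) * g) a 0 = (h * τ) a 0 := by rw [e]
  refine ⟨γ, τ 0 0, ?_, ?_, ?_⟩
  · rcases Int.isUnit_iff.mp (IsUnit.of_mul_eq_one _ hd.symm) with h1 | h1 <;> simp [h1]
  · have := hent 0
    simp only [coe_mul, Matrix.mul_apply, Fin.sum_univ_two, hγ] at this
    linarith
  · have := hent 1
    simp only [coe_mul, Matrix.mul_apply, Fin.sum_univ_two, hγ] at this
    linarith

theorem CuspEquiv.cuspDivisor_dvd {N : ℕ} {g h : SL(2, ℤ)} (hgh : CuspEquiv N g h) :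
    cuspDivisor N g ∣ cuspDivisor N h := by
  obtain ⟨γ, ε, hε, -, h1⟩ := hgh.exists_col
  have hN : (cuspDivisor N g : ℤ) ∣ N := Int.gcd_dvd_right _ _
  refine Int.dvd_gcd ?_ hN |> fun h => by exact_mod_cast h
  have : h 1 0 = ε * ((γ : SL(2, ℤ)) 1 0 * g 0 0 + (γ : SL(2, ℤ)) 1 1 * g 1 0) := by
    rw [← h1]; linear_combination -(h 1 0) * hε
  rw [this]
  refine Dvd.dvd.mul_left (dvd_add ?_ ?_) _
  · exact (hN.trans (mem_Gamma0_iff_dvd.mp γ.2)).mul_right _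
  · exact Dvd.dvd.mul_left (Int.gcd_dvd_left _ _) _

theorem CuspEquiv.cuspDivisor_eq {N : ℕ} {g h : SL(2, ℤ)} (hgh : CuspEquiv N g h) :
    cuspDivisor N g = cuspDivisor N h :=
  Nat.dvd_antisymm hgh.cuspDivisor_dvd hgh.symm.cuspDivisor_dvd

/-- Modulo G both C and M = N/C vanish, so αδ ≡ 1, εp' ≡ αp and εq' ≡ δq. Multiplying, the sign and
αδ drop out. -/
theorem dvd_residue_sub {G C M p q p' q' α β c δ ε : ℤ} (hGC : G ∣ C) (hGM : G ∣ M)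
    (hε : ε * ε = 1) (hd : α * δ - β * (C * M * c) = 1) (h0 : ε * p' = α * p + β * (C * q))
    (h1 : ε * q' = M * c * p + δ * q) : G ∣ p' * q' - p * q := by
  have e : p' * q' - p * q =
      M * (α * c * p ^ 2) + C * (2 * β * q * M * c * p + β * q ^ 2 * δ) := by
    linear_combination (-(p' * q')) * hε + (ε * q') * h0 + (α * p + β * (C * q)) * h1
      + p * q * hd
  rw [e]
  exact dvd_add (hGM.mul_right _) (hGC.mul_right _)

/-- As qq' is invertible modulo M, the congruence for t is solvable once gcd(C, M) divides q's -
qs'. Modulo that gcd, s and s' are inverse to p and p', so pp'(q's - qs') ≡ p'q' - pq. -/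
theorem exists_dvd_of_dvd_residue_sub {C M p q r s p' q' r' s' : ℤ} (hq : IsCoprime q M)
    (hq' : IsCoprime q' M) (hd : p * s - r * (C * q) = 1) (hd' : p' * s' - r' * (C * q') = 1)
    (hp : IsCoprime p (Int.gcd C M)) (hp' : IsCoprime p' (Int.gcd C M))
    (h : (Int.gcd C M : ℤ) ∣ p' * q' - p * q) :
    ∃ t, M ∣ q' * s - q * s' - t * (C * (q * q')) := by
  have hX : (Int.gcd C M : ℤ) ∣ q' * s - q * s' := by
    refine (hp.mul_left hp').symm.dvd_of_dvd_mul_left ?_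
    have e : p * p' * (q' * s - q * s') =
        (p' * q' - p * q) + C * (p' * q' * r * q - p * q * r' * q') := by
      linear_combination (p' * q') * hd - (p * q) * hd'
    rw [e]
    exact dvd_add h ((Int.gcd_dvd_left _ _).mul_right _)
  obtain ⟨k, hk⟩ := hX
  obtain ⟨w, v, hwv⟩ := hq.mul_left hq'
  have hb := Int.gcd_eq_gcd_ab C M
  -- Here `w` inverts qq' modulo M, and Bézout writes gcd(C, M) as a multiple of C modulo M.
  refine ⟨k * Int.gcdA C M * w, k * Int.gcdB C M + k * Int.gcdA C M * C * v, ?_⟩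
  rw [hk, hb]
  linear_combination (-(k * Int.gcdA C M * C)) * hwv

theorem cuspEquiv_iff {N : ℕ} [NeZero N] {g h : SL(2, ℤ)} :
    CuspEquiv N g h ↔ cuspDivisor N g = cuspDivisor N h ∧ cuspResidue N g = cuspResidue N h := by
  have hN : (N : ℤ) = cuspDivisor N g * (N / cuspDivisor N g : ℕ) := by
    exact_mod_cast (Nat.mul_div_cancel' (MockEisenstein.cuspDivisor_dvd N g)).symm
  have hC0 : (cuspDivisor N g : ℤ) ≠ 0 := by
    intro h; rw [h, zero_mul] at hN; exact NeZero.ne N (by exact_mod_cast hN)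
  have hq := cuspDivisor_mul N g
  have hq' := cuspDivisor_mul N h
  constructor
  · intro hgh
    have hC := hgh.cuspDivisor_eq
    refine ⟨hC, ?_⟩
    obtain ⟨γ, ε, hε, h0, h1⟩ := hgh.exists_col
    obtain ⟨c, hc⟩ := mem_Gamma0_iff_dvd.mp γ.2
    have hd := Matrix.det_fin_two ((γ : SL(2, ℤ)) : Matrix (Fin 2) (Fin 2) ℤ)
    unfold cuspResidue
    rw [← hC] at hq' ⊢
    rw [Matrix.SpecialLinearGroup.det_coe, hc, hN] at hd
    rw [← hq] at h0
    change _ ≡ _ [ZMOD _]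
    refine Int.modEq_iff_dvd.mpr
      (dvd_residue_sub (Int.natCast_dvd_natCast.mpr (cuspModulus_dvd_left _ _))
        (Int.natCast_dvd_natCast.mpr (cuspModulus_dvd_right _ _)) hε hd.symm h0
        (mul_left_cancel₀ hC0 ?_))
    rw [← hq', ← hq, hc] at h1
    linear_combination h1 + c * g 0 0 * hN
  · rintro ⟨hC, hR⟩
    have hco' := isCoprime_cofactor N h
    have hpG' := (isCoprime_residue N h).of_mul_left_left
    have hd := Matrix.det_fin_two (g : Matrix (Fin 2) (Fin 2) ℤ)
    have hd' := Matrix.det_fin_two (h : Matrix (Fin 2) (Fin 2) ℤ)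
    rw [Matrix.SpecialLinearGroup.det_coe] at hd hd'
    have hpG := (isCoprime_residue N g).of_mul_left_left
    have hG : cuspModulus N (cuspDivisor N g) =
      Int.gcd (cuspDivisor N g : ℤ) (N / cuspDivisor N g : ℕ) := (Int.gcd_natCast_natCast _ _).symm
    unfold cuspResidue at hR
    rw [← hC] at hq' hR hco' hpG'
    replace hR := Int.modEq_iff_dvd.mp hR
    rw [hG] at hpG hpG' hR
    obtain ⟨t, ht⟩ := exists_dvd_of_dvd_residue_sub (isCoprime_cofactor N g) hco'
      (hq.symm ▸ hd.symm) (hq'.symm ▸ hd'.symm) hpG hpG' hR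
    refine ⟨⟨h * T ^ t * g⁻¹, mem_Gamma0_iff_dvd.mpr ?_⟩, ?_⟩
    · rw [mul_T_zpow_mul_inv_apply, hN]
      refine (mul_dvd_mul_left (cuspDivisor N g : ℤ) ht).trans (dvd_of_eq ?_)
      generalize h 1 0 / (cuspDivisor N g : ℤ) = b at hq' ⊢
      generalize g 1 0 / (cuspDivisor N g : ℤ) = a at hq ⊢
      rw [← hq, ← hq']
      ring
    · rw [← mul_smul, ← map_mul, mapGL_smul_infty_eq_iff]
      simp [coe_T_zpow]

/-! ### Singular cusps and the conductor -/

/-- Since N ∣ d², every 1 + dx is a unit modulo N, with inverse 1 - dx. These elements therefore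
form exactly the kernel of reduction to level d. -/
theorem factorsThrough_iff_forall_one_add {N : ℕ} [NeZero N] {χ : DirichletCharacter ℂ N} {d : ℕ}
    (hd : d ∣ N) (hN : N ∣ d * d) :
    χ.FactorsThrough d ↔ ∀ x : ℤ, χ ((1 + d * x : ℤ) : ZMod N) = 1 := by
  constructor
  · rintro ⟨h, χ₀, rfl⟩ x
    have hco : IsCoprime (1 + d * x : ℤ) N := by
      obtain ⟨y, hy⟩ := hN
      have hy' : (d : ℤ) * d = N * y := by exact_mod_cast hy
      exact ⟨1 - d * x, y * x ^ 2, by linear_combination -x ^ 2 * hy'⟩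
    rw [DirichletCharacter.changeLevel_eq_cast_of_dvd' _ h hco]
    simp
  · intro h
    rw [DirichletCharacter.factorsThrough_iff_ker_unitsMap hd]
    intro u hu
    rw [MonoidHom.mem_ker, Units.ext_iff, ZMod.unitsMap_val, ← ZMod.natCast_val] at hu
    have h1 : (((1 : ℤ) : ZMod d)) = (((u : ZMod N).val : ℤ) : ZMod d) := by
      push_cast; exact hu.symm
    obtain ⟨x, hx⟩ := (ZMod.intCast_eq_intCast_iff_dvd_sub _ _ _).mp h1
    rw [MonoidHom.mem_ker, Units.ext_iff, MulChar.coe_toUnitHom, Units.val_one, ← h x, ← hx]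
    simp

theorem factorsThrough_star {N : ℕ} [NeZero N] {χ : DirichletCharacter ℂ N} {d : ℕ}
    (hd : d ∣ N) (hN : N ∣ d * d) : (star χ).FactorsThrough d ↔ χ.FactorsThrough d := by
  rw [factorsThrough_iff_forall_one_add hd hN, factorsThrough_iff_forall_one_add hd hN]
  exact forall_congr' fun x => by
    rw [MulChar.star_apply, ← starRingEnd_apply, map_eq_one_iff _ (starRingEnd ℂ).injective]

theorem factorsThrough_iff_conductor_dvd {N : ℕ} [NeZero N] {χ : DirichletCharacter ℂ N} {d : ℕ}
    (hd : d ∣ N) : χ.FactorsThrough d ↔ χ.conductor ∣ d :=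
  ⟨fun h => χ.conductor_dvd_of_mem_conductorSet h, fun h =>
    DirichletCharacter.FactorsThrough.mono χ χ.factorsThrough_conductor h hd⟩

/-- The width of the cusps `p / q` of `Γ₀(N)` with `gcd(q, N) = C`. -/
def cuspWidth (N C : ℕ) : ℕ := N / C / cuspModulus N C

theorem modulus_mul_width (N C : ℕ) : cuspModulus N C * cuspWidth N C = N / C :=
  Nat.mul_div_cancel' (cuspModulus_dvd_right N C)

theorem div_cuspModulus {N C : ℕ} [NeZero N] (hC : C ∣ N) :
    N / cuspModulus N C = C * cuspWidth N C := by
  have h := modulus_mul_width N C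
  have h' := Nat.mul_div_cancel' hC
  refine Nat.div_eq_of_eq_mul_right (Nat.pos_of_ne_zero fun h0 => ?_) ?_
  · rw [h0, zero_mul] at h; rw [← h, mul_zero] at h'; exact NeZero.ne N h'.symm
  · rw [mul_left_comm, h, h']

theorem cuspModulus_dvd {N C : ℕ} (hC : C ∣ N) : cuspModulus N C ∣ N :=
  (cuspModulus_dvd_left N C).trans hC

/-- Write N = CGw and C = Gc; then (N/G)² = (Cw)² = N·cw. This makes
`factorsThrough_iff_forall_one_add` available at d = N/G. -/
theorem dvd_mul_self_div_cuspModulus {N C : ℕ} [NeZero N] (hC : C ∣ N) :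
    N ∣ N / cuspModulus N C * (N / cuspModulus N C) := by
  obtain ⟨c, hc⟩ := cuspModulus_dvd_left N C
  have h := modulus_mul_width N C
  have h' := Nat.mul_div_cancel' hC
  rw [div_cuspModulus hC]
  refine ⟨c * cuspWidth N C, ?_⟩
  generalize cuspModulus N C = G at *
  generalize cuspWidth N C = w at *
  rw [← h', ← h]
  nth_rewrite 1 [hc]
  ring

theorem dvd_mul_right_iff_of_isCoprime {a b c : ℤ} (h : IsCoprime a c) : a ∣ b * c ↔ a ∣ b :=
  ⟨h.dvd_of_dvd_mul_right, fun h => h.mul_right _⟩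

/-- Cancel C, then the square of q/C, which is prime to N/C, then G; the remaining factor C/G is
prime to the width. -/
theorem dvd_mul_sq_iff {N : ℕ} [NeZero N] (g : SL(2, ℤ)) (t : ℤ) :
    (N : ℤ) ∣ t * g 1 0 ^ 2 ↔ (cuspWidth N (cuspDivisor N g) : ℤ) ∣ t := by
  have hq := cuspDivisor_mul N g
  have hco := isCoprime_cofactor N g
  have hN : (N : ℤ) = cuspDivisor N g * (N / cuspDivisor N g : ℕ) := by
    exact_mod_cast (Nat.mul_div_cancel' (cuspDivisor_dvd N g)).symm
  have hG := modulus_mul_width N (cuspDivisor N g)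
  have hM0 : N / cuspDivisor N g ≠ 0 := fun h => by
    rw [h, Nat.cast_zero, mul_zero] at hN; exact NeZero.ne N (by exact_mod_cast hN)
  have hC0 : (cuspDivisor N g : ℤ) ≠ 0 := fun h => by
    rw [h, zero_mul] at hN; exact NeZero.ne N (by exact_mod_cast hN)
  have hG0 : 0 < cuspModulus N (cuspDivisor N g) := Nat.pos_of_ne_zero fun h => by
    rw [h, zero_mul] at hG; exact hM0 hG.symm
  obtain ⟨c, hc⟩ := cuspModulus_dvd_left N (cuspDivisor N g)
  have hcw : IsCoprime (c : ℤ) (cuspWidth N (cuspDivisor N g)) := by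
    have h1 := Nat.coprime_div_gcd_div_gcd (m := cuspDivisor N g) (n := N / cuspDivisor N g) hG0
    rw [Nat.isCoprime_iff_coprime]
    have : c = cuspDivisor N g / cuspModulus N (cuspDivisor N g) :=
      (Nat.div_eq_of_eq_mul_right hG0 hc).symm
    rw [this]
    exact h1
  have hc' : (cuspDivisor N g : ℤ) = cuspModulus N (cuspDivisor N g) * c := by exact_mod_cast hc
  have hG' : ((N / cuspDivisor N g : ℕ) : ℤ) =
      cuspModulus N (cuspDivisor N g) * cuspWidth N (cuspDivisor N g) := by exact_mod_cast hG.symm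
  have hG0' : (cuspModulus N (cuspDivisor N g) : ℤ) ≠ 0 := by exact_mod_cast hG0.ne'
  rw [← hq, hN]
  generalize g 1 0 / (cuspDivisor N g : ℤ) = q at *
  have e1 : t * ((cuspDivisor N g : ℤ) * q) ^ 2 =
      cuspDivisor N g * ((t * cuspDivisor N g) * q ^ 2) := by ring
  have e2 : t * (cuspDivisor N g : ℤ) = cuspModulus N (cuspDivisor N g) * (t * c) := by
    rw [hc']; ring
  rw [e1, mul_dvd_mul_iff_left hC0, dvd_mul_right_iff_of_isCoprime hco.symm.pow_right, e2, hG',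
    mul_dvd_mul_iff_left hG0', dvd_mul_right_iff_of_isCoprime hcw.symm]

/-- For t = wu the argument is 1 + (N/G)·u·p(q/C). As p(q/C) is a unit modulo G, these run through
all residues 1 + (N/G)x. -/
theorem forall_character_eq_one_iff {N : ℕ} [NeZero N] (χ : DirichletCharacter ℂ N)
    (g : SL(2, ℤ)) :
    (∀ t : ℤ, (N : ℤ) ∣ t * g 1 0 ^ 2 → χ ((1 + t * (g 0 0 * g 1 0) : ℤ) : ZMod N) = 1) ↔
      cuspModulus N (cuspDivisor N g) ∣ N / (star χ).conductor := by
  have hC := cuspDivisor_dvd N g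
  have hGN := cuspModulus_dvd hC
  have hq := cuspDivisor_mul N g
  have hd : N / cuspModulus N (cuspDivisor N g) ∣ N := Nat.div_dvd_of_dvd hGN
  have hdd := dvd_mul_self_div_cuspModulus hC
  have hm := (star χ).conductor_dvd_level
  have hNG := div_cuspModulus hC
  have hNG' : ((N / cuspModulus N (cuspDivisor N g) : ℕ) : ℤ) =
    cuspDivisor N g * cuspWidth N (cuspDivisor N g) := by exact_mod_cast hNG
  have hNGN : (N : ℤ) = (N / cuspModulus N (cuspDivisor N g) : ℕ) *
      cuspModulus N (cuspDivisor N g) := by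
    exact_mod_cast (Nat.div_mul_cancel hGN).symm
  have hres := isCoprime_residue N g
  trans χ.FactorsThrough (N / cuspModulus N (cuspDivisor N g))
  · rw [factorsThrough_iff_forall_one_add hd hdd]
    simp only [dvd_mul_sq_iff]
    generalize g 1 0 / (cuspDivisor N g : ℤ) = q at *
    constructor
    · intro h x
      obtain ⟨a, b, hab⟩ := hres
      -- `a` inverts p(q/C) modulo G, so this t produces 1 + (N/G)x modulo N.
      rw [← h (cuspWidth N (cuspDivisor N g) * (a * x)) (dvd_mul_right _ _)]
      congr 1
      rw [ZMod.intCast_eq_intCast_iff_dvd_sub]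
      refine ⟨-(x * b), ?_⟩
      rw [← hq]
      generalize (cuspModulus N (cuspDivisor N g) : ℤ) = G at *
      generalize ((N / cuspModulus N (cuspDivisor N g) : ℕ) : ℤ) = n at *
      rw [hNGN]
      linear_combination (x * n) * hab - (a * x * g 0 0 * q) * hNG'
    · rintro h t ⟨u, rfl⟩
      rw [← h (u * (g 0 0 * q)), ← hq, hNG']
      congr 2
      ring
  -- With m the conductor, m ∣ N/G and G ∣ N/m both say mG ∣ N.
  · rw [← factorsThrough_star hd hdd, factorsThrough_iff_conductor_dvd hd,
      Nat.dvd_div_iff_mul_dvd hGN, Nat.dvd_div_iff_mul_dvd hm, mul_comm]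

theorem j_neg (g : SL(2, ℝ)) (z : ℍ) : j (-g) z = -j g z := by
  simp [j]; ring

theorem j_T_zpow_mul (t : ℤ) (h : SL(2, ℝ)) (z : ℍ) : j (toReal (T ^ t) * h) z = j h z := by
  rw [j_mul]
  simp [j, coe_T_zpow, -map_zpow]

theorem toReal_neg (g : SL(2, ℤ)) : toReal (-g) = -toReal g := by
  ext a b; simp

theorem exists_eq_conj_T_zpow {Γ : Subgroup SL(2, ℤ)} {g : SL(2, ℤ)} {δ : Γ}
    (hδ : δ ∈ cuspStabilizer Γ (mapGL ℝ g • OnePoint.infty)) :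
    ∃ t : ℤ, (δ : SL(2, ℤ)) = g * T ^ t * g⁻¹ ∨ (δ : SL(2, ℤ)) = -(g * T ^ t * g⁻¹) := by
  rw [mem_cuspStabilizer_iff] at hδ
  obtain ⟨t, ht⟩ := exists_eq_T_zpow hδ
  have e : (δ : SL(2, ℤ)) = g * (g⁻¹ * δ * g) * g⁻¹ := by group
  refine ⟨t, ht.imp (fun h => ?_) fun h => ?_⟩
  · rw [e, h]
  · rw [e, h]; simp

theorem conj_T_zpow_mem_cuspStabilizer {Γ : Subgroup SL(2, ℤ)} {g : SL(2, ℤ)} {t : ℤ}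
    (h : g * T ^ t * g⁻¹ ∈ Γ) :
    (⟨_, h⟩ : Γ) ∈ cuspStabilizer Γ (mapGL ℝ g • OnePoint.infty) := by
  rw [mem_cuspStabilizer_iff]
  have e : g⁻¹ * (g * T ^ t * g⁻¹) * g = T ^ t := by group
  rw [e]
  simp [coe_T_zpow]

theorem conj_T_zpow_mem_Gamma0 {N : ℕ} {g : SL(2, ℤ)} {t : ℤ} :
    g * T ^ t * g⁻¹ ∈ CongruenceSubgroup.Gamma0 N ↔ (N : ℤ) ∣ t * g 1 0 ^ 2 := by
  rw [mem_Gamma0_iff_dvd, conj_T_zpow_apply_one_zero, dvd_neg]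

theorem neg_mem_Gamma0 {N : ℕ} {g : SL(2, ℤ)} (hg : -g ∈ CongruenceSubgroup.Gamma0 N) :
    g ∈ CongruenceSubgroup.Gamma0 N := by
  rw [mem_Gamma0_iff_dvd] at *
  simpa using hg

/-- In integral weight the powers multiply, and for δ = ±gTᵗg⁻¹ one has j(σ⁻¹δ, z) = ±j(σ⁻¹, z). The
parity of χ cancels the sign, leaving a condition on χ alone. -/
theorem isSingular_nebentypus_iff {N : ℕ} [NeZero N] {χ : DirichletCharacter ℂ N} {k : ℤ}
    {hχ : χ (-1) = (-1) ^ k} {g : SL(2, ℤ)} {σ : SL(2, ℝ)}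
    (hσ : (σ : GL (Fin 2) ℝ) • (OnePoint.infty : OnePoint ℝ) = mapGL ℝ g • OnePoint.infty) :
    IsSingular (nebentypus χ k hχ) (mapGL ℝ g • OnePoint.infty) σ ↔
      cuspModulus N (cuspDivisor N g) ∣ N / (star χ).conductor := by
  rw [← forall_character_eq_one_iff]
  obtain ⟨x, -, hx⟩ := exists_j_eq hσ
  have hcpow (y : ℂ) : y ^ ((2 - (k : ℝ) : ℝ) : ℂ) = y ^ (2 - k : ℤ) := by
    rw [← Complex.cpow_intCast]; push_cast; rfl
  have hj (t : ℤ) (z : ℍ) : j (σ⁻¹ * toReal (g * T ^ t * g⁻¹)) z = j σ⁻¹ z := by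
    have e : (toReal g)⁻¹ * toReal (g * T ^ t * g⁻¹) = toReal (T ^ t) * ((toReal g)⁻¹ * 1) := by
      rw [map_mul, map_mul, map_inv]; group
    rw [hx, e, j_T_zpow_mul, ← hx, mul_one]
  have key (δ : CongruenceSubgroup.Gamma0 N) (t : ℤ) (z : ℍ)
      (h : (δ : SL(2, ℤ)) = g * T ^ t * g⁻¹ ∨ (δ : SL(2, ℤ)) = -(g * T ^ t * g⁻¹)) :
      nebentypus χ k hχ δ * j (incl _ δ) z ^ ((2 - (k : ℝ) : ℝ) : ℂ) *
        j σ⁻¹ (incl _ δ • z) ^ ((2 - (k : ℝ) : ℝ) : ℂ) =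
      χ ((1 + t * (g 0 0 * g 1 0) : ℤ) : ZMod N) * j σ⁻¹ z ^ (2 - k : ℤ) := by
    rw [hcpow, hcpow, mul_assoc, ← mul_zpow, mul_comm (j (incl _ δ) z), ← j_mul, incl_eq]
    change χ (((δ : SL(2, ℤ)) 1 1 : ℤ) : ZMod N) * _ = _
    rcases h with h | h
    · rw [h, conj_T_zpow_apply_one_one, hj]
    · rw [h, coe_neg, Matrix.neg_apply, conj_T_zpow_apply_one_one, toReal_neg, mul_neg, j_neg, hj,
        Int.cast_neg, neg_eq_neg_one_mul, map_mul, hχ, neg_eq_neg_one_mul (j σ⁻¹ z), mul_zpow]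
      have e : ((-1 : ℂ) ^ k) * (-1) ^ (2 - k) = 1 := by
        rw [← zpow_add₀ (by norm_num)]; simp
      linear_combination (χ ((1 + t * (g 0 0 * g 1 0) : ℤ) : ZMod N) * j σ⁻¹ z ^ (2 - k : ℤ)) * e
  constructor
  · intro h t ht
    have h1 := h _ (conj_T_zpow_mem_cuspStabilizer (conj_T_zpow_mem_Gamma0.mpr ht))
      UpperHalfPlane.I
    rw [key _ t _ (Or.inl rfl), hcpow] at h1
    exact mul_eq_right₀ (zpow_ne_zero _ (j_ne_zero _ _)) |>.mp h1
  · intro h δ hδ z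
    obtain ⟨t, ht⟩ := exists_eq_conj_T_zpow hδ
    rw [key δ t z ht, hcpow, h t, one_mul]
    refine conj_T_zpow_mem_Gamma0.mp ?_
    rcases ht with ht | ht
    · exact ht ▸ δ.2
    · exact neg_mem_Gamma0 (ht ▸ δ.2)

/-! ### Existence of cusps with given invariants -/

/-- The dilation matrix `diag(√h, 1 / √h)`. -/
noncomputable def dilation (h : ℝ) (hh : 0 < h) : SL(2, ℝ) :=
  ⟨!![√h, 0; 0, (√h)⁻¹], by simp [(Real.sqrt_pos.mpr hh).ne']⟩

theorem dilation_mul_T_zpow {h : ℕ} (hh : 0 < (h : ℝ)) (t : ℤ) :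
    dilation h hh * toReal (T ^ t) = toReal (T ^ (h * t : ℤ)) * dilation h hh := by
  have hT (t : ℤ) :
      ((toReal (T ^ t) : SL(2, ℝ)) : Matrix (Fin 2) (Fin 2) ℝ) = !![1, (t : ℝ); 0, 1] :=
    (Matrix.eta_fin_two _).trans (by simp [coe_T_zpow, -map_zpow])
  apply Subtype.ext
  rw [coe_mul, coe_mul, hT, hT]
  have hs := (Real.sqrt_pos.mpr hh).ne'
  have hs2 := Real.mul_self_sqrt hh.le
  simp [dilation]
  field_simp
  linear_combination (t : ℝ) * hs2

/-- A scaling matrix for the cusp `g ∞` of `Γ₀(N)`. -/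
theorem isScalingMatrix_dilation {N : ℕ} [NeZero N] (g : SL(2, ℤ))
    (hw : 0 < (cuspWidth N (cuspDivisor N g) : ℝ)) :
    IsScalingMatrix (CongruenceSubgroup.Gamma0 N) (mapGL ℝ g • OnePoint.infty)
      (toReal g * dilation _ hw) := by
  set D := dilation _ hw with hD
  constructor
  · rw [← coe_toReal, smul_infty_eq_iff]
    have e : ((toReal g)⁻¹ * (toReal g * D)) 1 0 = 0 := by
      rw [inv_mul_cancel_left, hD]; simp [dilation]
    exact e
  -- The dilation by the width w turns Tᵗ into T^(wt), and the elements gT^(wt)g⁻¹ are exactly the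
  -- gTˢg⁻¹ lying in Γ₀(N).
  have hconj (t : ℤ) : (toReal g * D) * toReal (T ^ t) * (toReal g * D)⁻¹ =
      toReal (g * T ^ (cuspWidth N (cuspDivisor N g) * t : ℤ) * g⁻¹) := by
    rw [mul_assoc (toReal g), hD, dilation_mul_T_zpow, map_mul, map_mul, map_inv]; group
  intro g'
  trans ∃ t : ℤ, g' = (toReal g * D) * toReal (T ^ t) * (toReal g * D)⁻¹ ∨
    g' = -((toReal g * D) * toReal (T ^ t) * (toReal g * D)⁻¹)
  · constructor
    · rintro ⟨γ, hγ, hg'⟩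
      obtain ⟨t, ht⟩ := exists_eq_conj_T_zpow hγ
      have hmem : g * T ^ t * g⁻¹ ∈ CongruenceSubgroup.Gamma0 N := by
        rcases ht with ht | ht
        · exact ht ▸ γ.2
        · exact neg_mem_Gamma0 (ht ▸ γ.2)
      obtain ⟨u, rfl⟩ := (dvd_mul_sq_iff g t).mp (conj_T_zpow_mem_Gamma0.mp hmem)
      refine ⟨u, ?_⟩
      rw [hconj]
      rw [incl_eq] at hg'
      rcases ht with ht | ht <;> rw [ht] at hg'
      · exact hg'
      · rw [toReal_neg, neg_neg] at hg'; exact hg'.symm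
    · rintro ⟨t, ht⟩
      rw [hconj] at ht
      exact ⟨_, conj_T_zpow_mem_cuspStabilizer (conj_T_zpow_mem_Gamma0.mpr
        ((dvd_mul_sq_iff g _).mpr (dvd_mul_right _ _))), ht⟩
  · generalize toReal g * D = σ
    have hT (t : ℤ) : (T ^ t : SL(2, ℤ)) 1 0 = 0 := by simp [coe_T_zpow]
    constructor
    · rintro ⟨t, rfl | rfl⟩
      · exact ⟨T ^ t, hT t, by change toReal _ = _; group⟩
      · refine ⟨-T ^ t, by simp [coe_T_zpow], ?_⟩
        change toReal _ = _
        rw [toReal_neg]; simp [mul_assoc]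
    · rintro ⟨τ, h0, hτ⟩
      change toReal _ = _ at hτ
      have e : g' = σ * toReal τ * σ⁻¹ := by rw [hτ]; group
      obtain ⟨t, rfl | rfl⟩ := exists_eq_T_zpow h0
      · exact ⟨t, Or.inl e⟩
      · exact ⟨t, Or.inr (by rw [e, toReal_neg]; simp)⟩

theorem exists_singularCusp {N : ℕ} [NeZero N] {χ : DirichletCharacter ℂ N} {k : ℤ}
    {hχ : χ (-1) = (-1) ^ k} (g : SL(2, ℤ))
    (hg : cuspModulus N (cuspDivisor N g) ∣ N / (star χ).conductor) :
    ∃ c : SingularCusp (nebentypus χ k hχ), c.pt = mapGL ℝ g • OnePoint.infty := by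
  have hw : 0 < (cuspWidth N (cuspDivisor N g) : ℝ) := by
    refine Nat.cast_pos.mpr (Nat.pos_of_ne_zero fun h => ?_)
    have h1 := Nat.div_mul_cancel (cuspModulus_dvd (cuspDivisor_dvd N g))
    rw [div_cuspModulus (cuspDivisor_dvd N g), h] at h1
    simp at h1
    exact NeZero.ne N h1.symm
  have hs := isScalingMatrix_dilation g hw
  exact ⟨⟨_, _, (Subgroup.IsArithmetic.isCusp_iff_isCusp_SL2Z _).mpr
    (isCusp_SL2Z_iff'.mpr ⟨g, rfl⟩), hs, (isSingular_nebentypus_iff hs.1).mpr hg⟩, rfl⟩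

/-- A unit modulo G lifts to a unit v modulo C, and the cusp v/C has divisor C, cofactor 1 and
residue v mod G. -/
theorem exists_cusp_data {N : ℕ} {C x : ℕ} (hC : C ∣ N) [NeZero N]
    (hx : x < cuspModulus N C) (hxc : (cuspModulus N C).Coprime x) :
    ∃ g : SL(2, ℤ), cuspDivisor N g = C ∧ cuspResidue N g = x := by
  have : NeZero C := ⟨fun h => NeZero.ne N (Nat.eq_zero_of_zero_dvd (h ▸ hC))⟩
  obtain ⟨v, hv⟩ := ZMod.unitsMap_surjective (cuspModulus_dvd_left N C)
    (ZMod.unitOfCoprime x hxc.symm)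
  have hp : IsCoprime ((v : ZMod C).val : ℤ) (C : ℤ) :=
    Nat.isCoprime_iff_coprime.mpr (ZMod.val_coe_unit_coprime v)
  obtain ⟨g, h0, h1⟩ := hp.exists_SL2_col 0
  have hD : cuspDivisor N g = C := by
    rw [cuspDivisor, h1, Int.gcd_natCast_natCast, Nat.gcd_eq_left hC]
  refine ⟨g, hD, ?_⟩
  rw [cuspResidue, hD, h0, h1, Int.ediv_self (by exact_mod_cast NeZero.ne C), mul_one]
  rw [Units.ext_iff, ZMod.unitsMap_val, ← ZMod.natCast_val, ZMod.coe_unitOfCoprime,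
    ZMod.natCast_eq_natCast_iff] at hv
  have : (v : ZMod C).val % cuspModulus N C = x :=
    Eq.trans hv (Nat.mod_eq_of_lt hx)
  exact_mod_cast this

/-! ### The dimension count -/

/-- Here `f` is a complete invariant of the classes of singular cusps, with image `S`; one series
per class is a basis. -/
theorem finrank_mockEisensteinSpace {Γ : Subgroup SL(2, ℤ)} {k : ℝ} (hk2 : 2 < k)
    (hk : ∃ m : ℤ, k = m / 2) (ν : MultiplierSystem Γ (2 - k)) {α : Type*} (S : Finset α)
    (f : SingularCusp ν → α) (hS : ∀ a, a ∈ S ↔ ∃ c, f c = a)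
    (hf : ∀ c c', f c = f c' ↔ ∃ γ : Γ, c'.pt = mapGL ℝ (γ : SL(2, ℤ)) • c.pt) :
    Module.finrank ℂ (mockEisensteinSpace k ν) = S.card := by
  choose rep hrep using fun a : S => (hS a).mp a.2
  have hind : LinearIndependent ℂ fun a => mockEisensteinSeries k ν (rep a) :=
    linearIndependent_mockEisensteinSeries hk2 rep fun a b hab γ h =>
      hab (Subtype.ext (by rw [← hrep a, ← hrep b]; exact ((hf _ _).mpr ⟨γ, h⟩).symm))
  have hspan : mockEisensteinSpace k ν =
      Submodule.span ℂ (Set.range fun a => mockEisensteinSeries k ν (rep a)) := by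
    refine le_antisymm (Submodule.span_le.mpr ?_) (Submodule.span_mono ?_)
    · rintro _ ⟨c, rfl⟩
      obtain ⟨γ, hγ⟩ := (hf (rep ⟨f c, (hS _).mpr ⟨c, rfl⟩⟩) c).mp (hrep _)
      obtain ⟨u, -, hu⟩ := mockEisensteinSeries_equivalent hk hγ
      rw [SetLike.mem_coe, hu]
      exact Submodule.smul_mem _ _ (Submodule.subset_span ⟨_, rfl⟩)
    · rintro _ ⟨a, rfl⟩
      exact ⟨_, rfl⟩
  rw [hspan, finrank_span_eq_card hind, Fintype.card_coe]

theorem finrank_mockEisensteinSpace_nebentypus (N : ℕ) [NeZero N] (k : ℤ) (hk : 3 ≤ k)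
    (χ : DirichletCharacter ℂ N) (hχ : χ (-1) = (-1) ^ k) :
    Module.finrank ℂ (mockEisensteinSpace (k : ℝ) (nebentypus χ k hχ)) =
      ∑ C ∈ N.divisors with Nat.gcd C (N / C) ∣ N / (star χ).conductor,
        Nat.totient (Nat.gcd C (N / C)) := by
  choose g hg using fun c : SingularCusp (nebentypus χ k hχ) => c.exists_rep
  have hG0 (g : SL(2, ℤ)) : (cuspModulus N (cuspDivisor N g) : ℤ) ≠ 0 := by
    have := Nat.pos_of_dvd_of_pos (cuspModulus_dvd (cuspDivisor_dvd N g)) (NeZero.pos N)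
    exact_mod_cast this.ne'
  have hres (g : SL(2, ℤ)) : 0 ≤ cuspResidue N g := Int.emod_nonneg _ (hG0 g)
  let S : Finset (Σ _ : ℕ, ℕ) :=
    {C ∈ N.divisors | Nat.gcd C (N / C) ∣ N / (star χ).conductor}.sigma fun C =>
      -- This is the set counted in the definition of `Nat.totient`; for modulus 1 it is {0}.
      {x ∈ Finset.range (Nat.gcd C (N / C)) | (Nat.gcd C (N / C)).Coprime x}
  have hcard : S.card = ∑ C ∈ N.divisors with Nat.gcd C (N / C) ∣ N / (star χ).conductor,
      Nat.totient (Nat.gcd C (N / C)) := Finset.card_sigma _ _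
  have hequiv (c c' : SingularCusp (nebentypus χ k hχ)) :
      (∃ γ : CongruenceSubgroup.Gamma0 N, c'.pt = mapGL ℝ (γ : SL(2, ℤ)) • c.pt) ↔
        CuspEquiv N (g c) (g c') := by
    rw [CuspEquiv, ← hg c, ← hg c']
  rw [← hcard]
  refine finrank_mockEisensteinSpace (by exact_mod_cast hk) ⟨2 * k, by push_cast; ring⟩ _ S
    (fun c => ⟨cuspDivisor N (g c), (cuspResidue N (g c)).toNat⟩) ?_ fun c c' => ?_
  · rintro ⟨C, x⟩
    simp only [S, Finset.mem_sigma, Finset.mem_filter, Nat.mem_divisors, Finset.mem_range]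
    constructor
    · rintro ⟨⟨⟨hC, -⟩, hm⟩, hx, hxc⟩
      obtain ⟨h, rfl, hr⟩ := exists_cusp_data hC hx hxc
      obtain ⟨c, hc⟩ := exists_singularCusp (hχ := hχ) h hm
      have he : CuspEquiv N (g c) h := ⟨1, by rw [← hg c, ← hc]; simp⟩
      obtain ⟨h1, h2⟩ := cuspEquiv_iff.mp he
      exact ⟨c, by rw [h1, h2, hr]; simp⟩
    · rintro ⟨c, hc⟩
      rw [Sigma.mk.injEq, heq_eq_eq] at hc
      obtain ⟨rfl, rfl⟩ := hc
      have hsing := c.isSingular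
      have hscal := c.isScaling.1
      rw [hg c] at hsing hscal
      refine ⟨⟨⟨cuspDivisor_dvd _ _, NeZero.ne N⟩, (isSingular_nebentypus_iff hscal).mp hsing⟩,
        ?_, ?_⟩
      · rw [Int.toNat_lt (hres _)]
        exact Int.emod_lt_of_pos _ (lt_of_le_of_ne (Int.natCast_nonneg _) (hG0 _).symm)
      · rw [← Nat.isCoprime_iff_coprime, Int.toNat_of_nonneg (hres _)]
        have := (isCoprime_residue N (g c)).symm
        rw [cuspResidue]
        rw [Int.emod_def, sub_eq_add_neg, ← mul_neg]
        exact this.add_mul_left_right _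
  · rw [hequiv, cuspEquiv_iff, Sigma.mk.injEq, heq_eq_eq]
    refine and_congr_right fun _ => ⟨fun h => ?_, fun h => by rw [h]⟩
    rw [← Int.toNat_of_nonneg (hres (g c)), h, Int.toNat_of_nonneg (hres _)]

end MockEisenstein

theorem corollary4p4 :
    (∀ (Γ : Subgroup SL(2, ℤ)) [Γ.FiniteIndex] (k : ℝ) (_ : ∃ m : ℤ, k = m / 2) (_ : 5 / 2 ≤ k)
        (ν : MockEisenstein.MultiplierSystem Γ (2 - k)),
      FiniteDimensional ℂ (MockEisenstein.mockEisensteinSpace k ν)) ∧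
    (∀ (N : ℕ) [NeZero N] (k : ℤ) (_ : 3 ≤ k) (χ : DirichletCharacter ℂ N)
        (hχ : χ (-1) = (-1) ^ k),
      Module.finrank ℂ
          (MockEisenstein.mockEisensteinSpace (k : ℝ) (MockEisenstein.nebentypus χ k hχ)) =
        ∑ C ∈ N.divisors with Nat.gcd C (N / C) ∣ N / (star χ).conductor,
          Nat.totient (Nat.gcd C (N / C))) := by
  refine ⟨fun Γ _ k hk _ ν => MockEisenstein.finiteDimensional_mockEisensteinSpace Γ hk ν, ?_⟩
  intro N _ k hk χ hχ
  exact MockEisenstein.finrank_mockEisensteinSpace_nebentypus N k hk χ hχ
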